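/- Consider a discrete memoryless compound multiple access channel with a relay (cMACr): finite input alphabets $\mathcal X_1,\mathcal X_2$ (transmitters 1, 2) and $\mathcal X_3$ (relay), finite output alphabets $\mathcal Y_1,\mathcal Y_2$ (receivers 1, 2) and $\mathcal Y_3$ (relay), and a transition law $p(y_1,y_2,y_3|x_1,x_2,x_3)$. A code of length $n$ and rates $(R_1,R_2,R_3)$ has independent, uniformly distributed messages $W_i\in\{1,\dots,\lfloor 2^{nR_i}\rfloor\}$, $i=1,2,3$; encoders $W_i\mapsto x_i^n$ for $i=1,2$; causal relay encoders $x_{3j}=g_j(W_3,y_3^{j-1})$, $j=1,\dots,n$; and at each receiver $i=1,2$ a decoder $y_i^n\mapsto(\hat W_1,\hat W_2,\hat W_3)$. It is in error if at least one receiver does not decode the triple $(W_1,W_2,W_3)$ correctly. A triple of nonnegative rates is achievable if there is a sequence of codes, one for each $n$, with these rates and with error probability tending to $0$; the capacity region is the closure of the set of achievable triples. A triple is achievable by decode-and-forward (DF) if it is achieved by codes of the following form. Time is divided into $B$ blocks of equal length, followed by fixed symbols ($B$ and the block length may depend on $n$). The message $W_i$, $i=1,2$, is split into sub-messages $w_{i,0},\dots,w_{i,B}$,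 with $w_{i,0}$ and $w_{i,B}$ fixed and known, and $W_3$ into $w_{3,1},\dots,w_{3,B}$. In block $b$ transmitter $i$ sends a codeword determined by $(w_{i,b-1},w_{i,b})$ (block-Markov encoding); the relay sends a codeword determined by $w_{3,b}$ and its estimates of $(w_{1,b-1},w_{2,b-1})$, and at the end of the block it decodes $(w_{1,b},w_{2,b})$ from what it received in this block, those estimates and $w_{3,b}$. Each receiver processes the blocks in the order $B,B-1,\dots,1$ and decodes $(w_{1,b-1},w_{2,b-1},w_{3,b})$ from what it received in block $b$ and its estimates of $(w_{1,b},w_{2,b})$ (backward decoding). Moreover, the probability that the relay does not decode $(W_1,W_2)$ correctly tends to $0$. Let $Q,U_1,U_2$ be auxiliary random variables with finite alphabets and let $$p(q)\,p(x_1,u_1|q)\,p(x_2,u_2|q)\,p(x_3|u_1,u_2,q)\,p(y_1,y_2,y_3|x_1,x_2,x_3)$$ be the joint distribution. Suppose that $R_1,R_2,R_3\ge 0$ satisfy (mutual informations in bits) \begin{align*} R_1&\le I(X_1;Y_3|U_1,X_2,X_3,Q),\\ R_2&\le I(X_2;Y_3|U_2,X_1,X_3,Q),\\ R_1+R_2&\le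 I(X_1,X_2;Y_3|U_1,U_2,X_3,Q),\\ R_3&\le \min\{I(X_3;Y_1|X_1,X_2,U_1,U_2,Q),\ I(X_3;Y_2|X_1,X_2,U_1,U_2,Q)\},\\ R_1+R_3&\le \min\{I(X_1,X_3;Y_1|X_2,U_2,Q),\ I(X_1,X_3;Y_2|X_2,U_2,Q)\},\\ R_2+R_3&\le \min\{I(X_2,X_3;Y_1|X_1,U_1,Q),\ I(X_2,X_3;Y_2|X_1,U_1,Q)\},\\ R_1+R_2+R_3&\le \min\{I(X_1,X_2,X_3;Y_1|Q),\ I(X_1,X_2,X_3;Y_2|Q)\}. \end{align*} Then $(\theta R_1,\theta R_2,\theta R_3)$ is achievable by DF for every $\theta\in[0,1)$ (so that every triple that satisfies all inequalities strictly is itself achievable by DF), and $(R_1,R_2,R_3)$ lies in the closure of the set of triples achievable by DF; in particular it lies in the capacity region. -/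

import Mathlib

open Filter Topology

noncomputable section

namespace CMACr

/-! ### Finite probability distributions and conditional mutual information -/

/-- Probability mass functions on a finite alphabet. -/
abbrev Dist (α : Type*) [Fintype α] := stdSimplex ℝ α

open Classical in
/-- The probability that the random variable `X` takes the value `a`, when the sample point has
probability mass function `p`. -/
def law {Ω A : Type*} [Fintype Ω] (p : Ω → ℝ) (X : Ω → A) (a : A) : ℝ :=
  ∑ ω, if X ω = a then p ω else 0

/-- The conditional mutual information `I(A; B | C)` in bits,
`∑ p(a,b,c) log₂ (p(a,b,c) p(c) / (p(a,c) p(b,c)))`; terms with `p(a,b,c) = 0` contribute `0`. -/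
def condMI {Ω A B C : Type*} [Fintype Ω] [Fintype A] [Fintype B] [Fintype C] (p : Ω → ℝ)
    (X : Ω → A) (Y : Ω → B) (Z : Ω → C) : ℝ :=
  ∑ a, ∑ b, ∑ c, law p (fun ω => (X ω, Y ω, Z ω)) (a, b, c) *
    Real.logb 2 ((law p (fun ω => (X ω, Y ω, Z ω)) (a, b, c) * law p Z c) /
      (law p (fun ω => (X ω, Z ω)) (a, c) * law p (fun ω => (Y ω, Z ω)) (b, c)))

/-! ### The channel and its codes -/

/-- The transition law `p(y₁, y₂, y₃ | x₁, x₂, x₃)` of a discrete memoryless compound multiple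
access channel with a relay; `x₃` and `y₃` are the input and the output of the relay. -/
abbrev Channel (X₁ X₂ X₃ Y₁ Y₂ Y₃ : Type*) [Fintype Y₁] [Fintype Y₂] [Fintype Y₃] :=
  X₁ → X₂ → X₃ → Dist (Y₁ × Y₂ × Y₃)

/-- A code of length `n` with `M₁`, `M₂`, `M₃` messages. The relay is causal: its `j`-th input
depends on its own message and on the outputs that it has received strictly before time `j`. -/
structure Code (X₁ X₂ X₃ Y₁ Y₂ Y₃ : Type*) (M₁ M₂ M₃ n : ℕ) where
  enc₁ : Fin M₁ → Fin n → X₁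
  enc₂ : Fin M₂ → Fin n → X₂
  relay : (j : Fin n) → Fin M₃ → (Fin j → Y₃) → X₃
  dec₁ : (Fin n → Y₁) → Fin M₁ × Fin M₂ × Fin M₃
  dec₂ : (Fin n → Y₂) → Fin M₁ × Fin M₂ × Fin M₃

/-- The part of a sequence that precedes time `j`. -/
def past {Y : Type*} {n : ℕ} (y : Fin n → Y) (j : Fin n) : Fin j → Y :=
  fun i => y ⟨i, i.isLt.trans j.isLt⟩

section
variable {X₁ X₂ X₃ Y₁ Y₂ Y₃ : Type*} [Fintype Y₁] [Fintype Y₂] [Fintype Y₃]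

/-- The probability that the channel outputs are `y` when the messages `w₁, w₂, w₃` are sent. -/
def outputProb (W : Channel X₁ X₂ X₃ Y₁ Y₂ Y₃) {M₁ M₂ M₃ n : ℕ}
    (c : Code X₁ X₂ X₃ Y₁ Y₂ Y₃ M₁ M₂ M₃ n) (w₁ : Fin M₁) (w₂ : Fin M₂) (w₃ : Fin M₃)
    (y : Fin n → Y₁ × Y₂ × Y₃) : ℝ :=
  ∏ j, (W (c.enc₁ w₁ j) (c.enc₂ w₂ j) (c.relay j w₃ (past (fun i => (y i).2.2) j))).1 (y j)

open Classical in
/-- The probability of the event `E` (on messages and channel outputs) when the three messages are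
independent and uniformly distributed. -/
def averageProb (W : Channel X₁ X₂ X₃ Y₁ Y₂ Y₃) {M₁ M₂ M₃ n : ℕ}
    (c : Code X₁ X₂ X₃ Y₁ Y₂ Y₃ M₁ M₂ M₃ n)
    (E : Fin M₁ → Fin M₂ → Fin M₃ → (Fin n → Y₁ × Y₂ × Y₃) → Prop) : ℝ :=
  1 / ((M₁ : ℝ) * M₂ * M₃) * ∑ w₁, ∑ w₂, ∑ w₃, ∑ y,
    if E w₁ w₂ w₃ y then outputProb W c w₁ w₂ w₃ y else 0

/-- The average probability of block error: at least one of the two receivers does not decode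
the message triple correctly. -/
def errorProb (W : Channel X₁ X₂ X₃ Y₁ Y₂ Y₃) {M₁ M₂ M₃ n : ℕ}
    (c : Code X₁ X₂ X₃ Y₁ Y₂ Y₃ M₁ M₂ M₃ n) : ℝ :=
  averageProb W c fun w₁ w₂ w₃ y =>
    c.dec₁ (fun i => (y i).1) ≠ (w₁, w₂, w₃) ∨ c.dec₂ (fun i => (y i).2.1) ≠ (w₁, w₂, w₃)

/-- The number of messages `⌊2 ^ (n R)⌋` of a code of length `n` and rate `R`. -/
def numMsgs (R : ℝ) (n : ℕ) : ℕ := ⌊(2 : ℝ) ^ ((n : ℝ) * R)⌋₊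

/-- The set of achievable rate triples. -/
def achievableRates (W : Channel X₁ X₂ X₃ Y₁ Y₂ Y₃) : Set (ℝ × ℝ × ℝ) :=
  {R | 0 ≤ R.1 ∧ 0 ≤ R.2.1 ∧ 0 ≤ R.2.2 ∧
    ∃ c : ∀ n, Code X₁ X₂ X₃ Y₁ Y₂ Y₃ (numMsgs R.1 n) (numMsgs R.2.1 n) (numMsgs R.2.2 n) n,
      Tendsto (fun n => errorProb W (c n)) atTop (𝓝 0)}

/-- The capacity region: the closure of the set of achievable rate triples. -/
def capacityRegion (W : Channel X₁ X₂ X₃ Y₁ Y₂ Y₃) : Set (ℝ × ℝ × ℝ) :=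
  closure (achievableRates W)

end

/-! ### Decode-and-forward with block-Markov encoding and backward decoding -/

/-- The data of a decode-and-forward scheme. The transmission consists of `B` blocks of length `m`,
followed by `n - B m` fixed symbols. The message of source `i = 1, 2` is split into sub-messages
`w_{i,0}, …, w_{i,B}`, of which `w_{i,0}` and `w_{i,B}` are fixed and known to everybody; in the
block `b = 1, …, B` (the element `b - 1` of `Fin B`) source `i` sends a codeword that is determined
by `w_{i,b-1}` and `w_{i,b}`. The message of the relay is split into `w_{3,1}, …, w_{3,B}`. -/
structure DFScheme (X₁ X₂ X₃ Y₁ Y₂ Y₃ : Type*) (M₁ M₂ M₃ n : ℕ) where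
  B : ℕ
  m : ℕ
  fits : B * m ≤ n
  K₁ : ℕ
  K₂ : ℕ
  K₃ : ℕ
  /-- the fixed first and last sub-messages -/
  dummy₁ : Fin K₁
  dummy₂ : Fin K₂
  split₁ : Fin M₁ → Fin (B + 1) → Fin K₁
  split₂ : Fin M₂ → Fin (B + 1) → Fin K₂
  split₃ : Fin M₃ → Fin B → Fin K₃
  first₁ : ∀ w, split₁ w 0 = dummy₁
  first₂ : ∀ w, split₂ w 0 = dummy₂
  last₁ : ∀ w, split₁ w (Fin.last B) = dummy₁
  last₂ : ∀ w, split₂ w (Fin.last B) = dummy₂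
  /-- recovery of a message from its sub-messages -/
  merge₁ : (Fin (B + 1) → Fin K₁) → Fin M₁
  merge₂ : (Fin (B + 1) → Fin K₂) → Fin M₂
  merge₃ : (Fin B → Fin K₃) → Fin M₃
  merge_split₁ : ∀ w, merge₁ (split₁ w) = w
  merge_split₂ : ∀ w, merge₂ (split₂ w) = w
  merge_split₃ : ∀ w, merge₃ (split₃ w) = w
  /-- codewords of the sources, indexed by the block, the previous and the fresh sub-message -/
  codeword₁ : Fin B → Fin K₁ → Fin K₁ → Fin m → X₁
  codeword₂ : Fin B → Fin K₂ → Fin K₂ → Fin m → X₂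
  /-- codewords of the relay, indexed by the block, the previous sub-messages of the two sources
  and the current sub-message of the relay -/
  codeword₃ : Fin B → Fin K₁ × Fin K₂ → Fin K₃ → Fin m → X₃
  /-- symbols sent after the last block -/
  fill₁ : X₁
  fill₂ : X₂
  fill₃ : X₃
  /-- at the end of a block the relay decodes the fresh sub-messages of the two sources from what it
  received in this block, its estimates of the previous sub-messages and its own sub-message -/
  relayDec : Fin B → Fin K₁ × Fin K₂ → Fin K₃ → (Fin m → Y₃) → Fin K₁ × Fin K₂
  /-- a receiver decodes the previous sub-messages of the two sources and the sub-message of the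
  relay from what it received in a block and its estimates of the fresh sub-messages -/
  recvDec₁ : Fin B → Fin K₁ × Fin K₂ → (Fin m → Y₁) → (Fin K₁ × Fin K₂) × Fin K₃
  recvDec₂ : Fin B → Fin K₁ × Fin K₂ → (Fin m → Y₂) → (Fin K₁ × Fin K₂) × Fin K₃

namespace DFScheme

variable {X₁ X₂ X₃ Y₁ Y₂ Y₃ : Type*} {M₁ M₂ M₃ n : ℕ}
  (S : DFScheme X₁ X₂ X₃ Y₁ Y₂ Y₃ M₁ M₂ M₃ n)

/-- The time at which the `k`-th symbol of the block `b` is sent: `b m + k`. -/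
def time (b : Fin S.B) (k : Fin S.m) : Fin n :=
  Fin.castLE S.fits (finProdFinEquiv (b, k))

/-- The block `b` of a sequence of length `n`. -/
def block {Y : Type*} (y : Fin n → Y) (b : Fin S.B) : Fin S.m → Y :=
  fun k => y (S.time b k)

/-- The relay's estimates of the sub-messages of the two sources, computed forwards. -/
def relayEst (w₃ : Fin M₃) (y₃ : Fin n → Y₃) (b : Fin (S.B + 1)) : Fin S.K₁ × Fin S.K₂ :=
  Fin.induction (motive := fun _ => Fin S.K₁ × Fin S.K₂) (S.dummy₁, S.dummy₂)
    (fun b prev => S.relayDec b prev (S.split₃ w₃ b) (S.block y₃ b)) b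

/-- A receiver's estimates of the sub-messages of the two sources, computed backwards from the
last block by the block decoder `d`. -/
def backEst {Y : Type*}
    (d : Fin S.B → Fin S.K₁ × Fin S.K₂ → (Fin S.m → Y) → (Fin S.K₁ × Fin S.K₂) × Fin S.K₃)
    (y : Fin n → Y) (b : Fin (S.B + 1)) : Fin S.K₁ × Fin S.K₂ :=
  Fin.reverseInduction (motive := fun _ => Fin S.K₁ × Fin S.K₂) (S.dummy₁, S.dummy₂)
    (fun b fresh => (d b fresh (S.block y b)).1) b

/-- The message triple that a receiver with the block decoder `d` obtains by backward decoding. -/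
def backDec {Y : Type*}
    (d : Fin S.B → Fin S.K₁ × Fin S.K₂ → (Fin S.m → Y) → (Fin S.K₁ × Fin S.K₂) × Fin S.K₃)
    (y : Fin n → Y) : Fin M₁ × Fin M₂ × Fin M₃ :=
  (S.merge₁ fun b => (S.backEst d y b).1, S.merge₂ fun b => (S.backEst d y b).2,
    S.merge₃ fun b => (d b (S.backEst d y b.succ) (S.block y b)).2)

/-- The relay's estimate of the messages of the two sources. -/
def relayMsgs (w₃ : Fin M₃) (y₃ : Fin n → Y₃) : Fin M₁ × Fin M₂ :=
  (S.merge₁ fun b => (S.relayEst w₃ y₃ b).1, S.merge₂ fun b => (S.relayEst w₃ y₃ b).2)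

/-- The code `c` operates according to the decode-and-forward scheme `S`. -/
structure Implements (c : Code X₁ X₂ X₃ Y₁ Y₂ Y₃ M₁ M₂ M₃ n) : Prop where
  enc₁ : ∀ w b k, c.enc₁ w (S.time b k) =
    S.codeword₁ b (S.split₁ w b.castSucc) (S.split₁ w b.succ) k
  enc₂ : ∀ w b k, c.enc₂ w (S.time b k) =
    S.codeword₂ b (S.split₂ w b.castSucc) (S.split₂ w b.succ) k
  relay : ∀ w y₃ b k, c.relay (S.time b k) w (past y₃ (S.time b k)) =
    S.codeword₃ b (S.relayEst w y₃ b.castSucc) (S.split₃ w b) k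
  enc_fill₁ : ∀ w (j : Fin n), S.B * S.m ≤ j → c.enc₁ w j = S.fill₁
  enc_fill₂ : ∀ w (j : Fin n), S.B * S.m ≤ j → c.enc₂ w j = S.fill₂
  relay_fill : ∀ w y₃ (j : Fin n), S.B * S.m ≤ j → c.relay j w (past y₃ j) = S.fill₃
  dec₁ : ∀ y, c.dec₁ y = S.backDec S.recvDec₁ y
  dec₂ : ∀ y, c.dec₂ y = S.backDec S.recvDec₂ y

end DFScheme

section
variable {X₁ X₂ X₃ Y₁ Y₂ Y₃ : Type*} [Fintype Y₁] [Fintype Y₂] [Fintype Y₃]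

/-- The average probability that the relay does not decode the messages of both sources. -/
def relayErrorProb (W : Channel X₁ X₂ X₃ Y₁ Y₂ Y₃) {M₁ M₂ M₃ n : ℕ}
    (c : Code X₁ X₂ X₃ Y₁ Y₂ Y₃ M₁ M₂ M₃ n) (S : DFScheme X₁ X₂ X₃ Y₁ Y₂ Y₃ M₁ M₂ M₃ n) : ℝ :=
  averageProb W c fun w₁ w₂ w₃ y => S.relayMsgs w₃ (fun i => (y i).2.2) ≠ (w₁, w₂)

/-- The set of rate triples that are achievable by decode-and-forward: they are achieved by codes
that implement decode-and-forward schemes, and the relay, too, decodes the messages of both sources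
with vanishing error probability. -/
def dfAchievableRates (W : Channel X₁ X₂ X₃ Y₁ Y₂ Y₃) : Set (ℝ × ℝ × ℝ) :=
  {R | 0 ≤ R.1 ∧ 0 ≤ R.2.1 ∧ 0 ≤ R.2.2 ∧
    ∃ (c : ∀ n, Code X₁ X₂ X₃ Y₁ Y₂ Y₃ (numMsgs R.1 n) (numMsgs R.2.1 n) (numMsgs R.2.2 n) n)
      (S : ∀ n, DFScheme X₁ X₂ X₃ Y₁ Y₂ Y₃
        (numMsgs R.1 n) (numMsgs R.2.1 n) (numMsgs R.2.2 n) n),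
      (∀ n, (S n).Implements (c n)) ∧
      Tendsto (fun n => errorProb W (c n)) atTop (𝓝 0) ∧
      Tendsto (fun n => relayErrorProb W (c n) (S n)) atTop (𝓝 0)}

end

/-! ### The single-letter distribution -/

/-- The factors `p(q)`, `p(x₁, u₁ | q)`, `p(x₂, u₂ | q)` and `p(x₃ | u₁, u₂, q)`. -/
structure InputLaw (Q U₁ U₂ X₁ X₂ X₃ : Type*) [Fintype Q] [Fintype U₁] [Fintype U₂]
    [Fintype X₁] [Fintype X₂] [Fintype X₃] where
  q : Dist Q
  xu₁ : Q → Dist (X₁ × U₁)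
  xu₂ : Q → Dist (X₂ × U₂)
  x₃ : U₁ → U₂ → Q → Dist X₃

/-- The values of all single-letter random variables. -/
structure Letters (Q U₁ U₂ X₁ X₂ X₃ Y₁ Y₂ Y₃ : Type*) where
  q : Q
  u₁ : U₁
  u₂ : U₂
  x₁ : X₁
  x₂ : X₂
  x₃ : X₃
  y₁ : Y₁
  y₂ : Y₂
  y₃ : Y₃

section
variable {Q U₁ U₂ X₁ X₂ X₃ Y₁ Y₂ Y₃ : Type*} [Fintype Q] [Fintype U₁] [Fintype U₂]
  [Fintype X₁] [Fintype X₂] [Fintype X₃] [Fintype Y₁] [Fintype Y₂] [Fintype Y₃]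

instance : Fintype (Letters Q U₁ U₂ X₁ X₂ X₃ Y₁ Y₂ Y₃) :=
  Fintype.ofEquiv (Q × U₁ × U₂ × X₁ × X₂ × X₃ × Y₁ × Y₂ × Y₃)
    { toFun := fun (q, u₁, u₂, x₁, x₂, x₃, y₁, y₂, y₃) => ⟨q, u₁, u₂, x₁, x₂, x₃, y₁, y₂, y₃⟩
      invFun := fun ω => (ω.q, ω.u₁, ω.u₂, ω.x₁, ω.x₂, ω.x₃, ω.y₁, ω.y₂, ω.y₃)
      left_inv := fun _ => rfl
      right_inv := fun _ => rfl }

/-- The joint distribution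
`p(q) p(x₁, u₁ | q) p(x₂, u₂ | q) p(x₃ | u₁, u₂, q) p(y₁, y₂, y₃ | x₁, x₂, x₃)`. -/
def InputLaw.joint (P : InputLaw Q U₁ U₂ X₁ X₂ X₃) (W : Channel X₁ X₂ X₃ Y₁ Y₂ Y₃)
    (ω : Letters Q U₁ U₂ X₁ X₂ X₃ Y₁ Y₂ Y₃) : ℝ :=
  P.q.1 ω.q * (P.xu₁ ω.q).1 (ω.x₁, ω.u₁) * (P.xu₂ ω.q).1 (ω.x₂, ω.u₂) *
    (P.x₃ ω.u₁ ω.u₂ ω.q).1 ω.x₃ * (W ω.x₁ ω.x₂ ω.x₃).1 (ω.y₁, ω.y₂, ω.y₃)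

end

end CMACr

end

/-! Random coding, with information-density tests in place of joint typicality, in a number of
blocks that stays fixed as the length grows.

One letter of a random codebook consists of `q`, of a letter `u` for each previous sub-message of a
source, of a letter `x` for each fresh one, drawn given that `u`, and of a relay letter for each
triple of sub-messages, drawn given `u₁`, `u₂`, `q`. A decoder accepts a candidate if, for each
relevant mutual information `I`, the product of the quotients `density` over the block exceeds `2 ^
(m γ)`, with `γ < I`. The true letters have the single-letter law, and a Chernoff bound
(`exists_expect_rpow_lt_one`) makes rejection exponentially rare. For a wrong candidate, the letters
that it renews are drawn afresh from their conditional law, independently of the output. The density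
then has mean at most one (`expect_density_le_one`), and Markov's inequality bounds acceptance by `2
^ (-(m γ))`. The union bound closes when the rate of the wrong candidates is below `γ`.

The form of the inequalities reflects which letters are renewed. At the relay, a wrong fresh
sub-message renews `x` but not `u`. At a receiver, a wrong previous sub-message renews `u`, `x` and
the relay letter, whatever the relay sub-message is; a wrong relay sub-message alone renews only
`x₃`. Non-strict inequalities suffice: a positive rate becomes strictly smaller than `I` after
scaling by `ρ < 1`, and a zero rate leaves one sub-message, hence no wrong candidate.

The blocks are chained in `sum_outputProb_le`. Failure of a block refers to decoders that are given
the true sub-messages. If no block fails, induction forwards at the relay and backwards at the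
receivers makes all estimates correct, and the relay sends what a genie-aided relay would send. The
real and the genie-aided output laws therefore agree on outcomes without failure. Both have mass
one, so failure is equally likely under both, and the genie-aided law is a product to which a union
bound over blocks applies. -/

noncomputable section

namespace CMACr

set_option linter.unusedSectionVars false

/-! ### Expectations under finite product and composed distributions. -/

section Expectation
variable {α β γ ι κ : Type*} [Fintype α] [Fintype β] [Fintype γ] [Fintype ι] [DecidableEq ι]
  [Fintype κ] [DecidableEq κ]

/-- The expectation of `f` under the distribution `d`. -/
def expect (d : Dist α) (f : α → ℝ) : ℝ := ∑ a, d.1 a * f a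

@[simp] lemma expect_const (d : Dist α) (c : ℝ) : expect d (fun _ => c) = c := by
  rw [expect, ← Finset.sum_mul, d.2.2, one_mul]

lemma expect_mul_left (d : Dist α) (c : ℝ) (f : α → ℝ) :
    expect d (fun a => c * f a) = c * expect d f := by
  simp only [expect, Finset.mul_sum, mul_left_comm]

lemma expect_congr (d : Dist α) {f g : α → ℝ} (h : ∀ a, f a = g a) : expect d f = expect d g := by
  rw [funext h]

lemma expect_add (d : Dist α) (f g : α → ℝ) :
    expect d (fun a => f a + g a) = expect d f + expect d g := by
  simp only [expect, mul_add, Finset.sum_add_distrib]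

lemma expect_sum {κ : Type*} (d : Dist α) (s : Finset κ) (f : κ → α → ℝ) :
    expect d (fun a => ∑ k ∈ s, f k a) = ∑ k ∈ s, expect d (f k) := by
  simp only [expect, Finset.mul_sum]
  exact Finset.sum_comm

lemma expect_comm (d : Dist α) (e : Dist β) (f : α → β → ℝ) :
    expect d (fun a => expect e (f a)) = expect e (fun b => expect d (fun a => f a b)) := by
  simp only [expect, Finset.mul_sum]
  rw [Finset.sum_comm]
  simp only [mul_left_comm]

lemma expect_mono_of_pos (d : Dist α) {f g : α → ℝ} (h : ∀ a, 0 < d.1 a → f a ≤ g a) :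
    expect d f ≤ expect d g := by
  refine Finset.sum_le_sum fun a _ => ?_
  rcases (d.2.1 a).eq_or_lt with h0 | h0
  · simp [← h0]
  · exact mul_le_mul_of_nonneg_left (h a h0) h0.le

lemma expect_mono (d : Dist α) {f g : α → ℝ} (h : ∀ a, f a ≤ g a) : expect d f ≤ expect d g :=
  expect_mono_of_pos d fun a _ => h a

lemma expect_nonneg (d : Dist α) {f : α → ℝ} (h : ∀ a, 0 ≤ f a) : 0 ≤ expect d f :=
  Finset.sum_nonneg fun a _ => mul_nonneg (d.2.1 a) (h a)

lemma exists_le_of_expect_le (d : Dist α) {f : α → ℝ} {c : ℝ} (h : expect d f ≤ c) :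
    ∃ a, f a ≤ c := by
  by_contra! hc
  obtain ⟨a, -, ha⟩ : ∃ a ∈ Finset.univ, (0 : ℝ) < d.1 a := by
    apply Finset.exists_lt_of_sum_lt
    simp [d.2.2]
  have h1 : expect d (fun _ => c) < expect d f :=
    Finset.sum_lt_sum (fun b _ => mul_le_mul_of_nonneg_left (hc b).le (d.2.1 b))
      ⟨a, Finset.mem_univ a, mul_lt_mul_of_pos_left (hc a) ha⟩
  rw [expect_const] at h1
  linarith

/-- The joint distribution of a random variable with distribution `d` and of one whose conditional
distribution is given by the kernel `k`. -/
def compProd (d : Dist α) (k : α → Dist β) : Dist (α × β) :=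
  ⟨fun x => d.1 x.1 * (k x.1).1 x.2, fun x => mul_nonneg (d.2.1 _) ((k _).2.1 _), by
    simp only [Fintype.sum_prod_type, ← Finset.mul_sum, (k _).2.2, mul_one, d.2.2]⟩

lemma expect_compProd (d : Dist α) (k : α → Dist β) (f : α × β → ℝ) :
    expect (compProd d k) f = expect d fun a => expect (k a) fun b => f (a, b) := by
  simp only [expect, compProd, Fintype.sum_prod_type, Finset.mul_sum, mul_assoc]

/-- The distribution of a family of independent random variables. -/
def piDist (d : ι → Dist α) : Dist (ι → α) :=
  ⟨fun x => ∏ i, (d i).1 (x i), fun x => Finset.prod_nonneg fun i _ => (d i).2.1 _, by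
    rw [← Fintype.piFinset_univ, ← Finset.prod_univ_sum]
    simp [(d _).2.2]⟩

lemma expect_piDist_prod (d : ι → Dist α) (f : ι → α → ℝ) :
    expect (piDist d) (fun x => ∏ i, f i (x i)) = ∏ i, expect (d i) (f i) := by
  simp only [expect, piDist, ← Finset.prod_mul_distrib]
  rw [Finset.prod_univ_sum, Fintype.piFinset_univ]

lemma expect_piDist_apply (d : ι → Dist α) (i : ι) (g : α → ℝ) :
    expect (piDist d) (fun x => g (x i)) = expect (d i) g := by
  have h := expect_piDist_prod d (fun j a => if j = i then g a else 1)
  simp only [Finset.prod_ite_eq', Finset.mem_univ, if_true] at h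
  rw [h, ← Finset.mul_prod_erase _ _ (Finset.mem_univ i), Finset.prod_eq_one, mul_one]
  · simp
  · intro j hj
    simp [Finset.ne_of_mem_erase hj]

-- Coordinates outside the range of `e` integrate to one. To use the product formula, `g` is
-- expanded into indicators of points, each written as a product over all of `ι` with factor one off
-- the range.
open Classical in
lemma expect_piDist_comp (d : ι → Dist α) {e : κ → ι} (he : Function.Injective e)
    (g : (κ → α) → ℝ) :
    expect (piDist d) (fun x => g (x ∘ e)) = expect (piDist (d ∘ e)) g := by
  have hg : ∀ x : ι → α, g (x ∘ e) =
      ∑ z, g z * ∏ i, ∏ k, if e k = i then (if x i = z k then 1 else 0) else 1 := by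
    intro x
    have h1 : ∀ z : κ → α, (∏ i, ∏ k, if e k = i then (if x i = z k then (1 : ℝ) else 0) else 1) =
        if z = x ∘ e then 1 else 0 := by
      intro z
      rw [Finset.prod_comm]
      simp only [Finset.prod_ite_eq, Finset.mem_univ, if_true]
      rw [Finset.prod_ite_zero]
      simp only [Finset.mem_univ, true_imp_iff, Finset.prod_const_one]
      refine if_congr ?_ rfl rfl
      rw [funext_iff]
      exact forall_congr' fun k => eq_comm
    simp [h1]
  rw [funext hg, expect_sum]
  simp only [expect_mul_left]
  unfold expect
  refine Finset.sum_congr rfl fun z _ => ?_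
  rw [mul_comm]
  congr 1
  have h2 := expect_piDist_prod d
    (fun i a => ∏ k, if e k = i then (if a = z k then (1 : ℝ) else 0) else 1)
  unfold expect at h2
  rw [h2]
  have h3 : ∀ i, (∑ a, (d i).1 a * ∏ k, if e k = i then (if a = z k then (1 : ℝ) else 0) else 1) =
      ∏ k, if e k = i then (d i).1 (z k) else 1 := by
    intro i
    by_cases hi : ∃ k, e k = i
    · obtain ⟨k, rfl⟩ := hi
      simp [he.eq_iff]
    · push Not at hi
      simp [hi, (d i).2.2]
  rw [Finset.prod_congr rfl fun i _ => h3 i, Finset.prod_comm]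
  simp [piDist]

lemma expect_piDist_apply₂ (d : ι → Dist α) {i j : ι} (h : i ≠ j) (g : α → α → ℝ) :
    expect (piDist d) (fun x => g (x i) (x j)) =
      expect (d i) fun a => expect (d j) fun b => g a b := by
  have he : Function.Injective (fun k : Bool => if k then i else j) := by
    intro a b hab
    rcases a <;> rcases b <;> simp_all [eq_comm]
  have h1 := expect_piDist_comp d he (fun x => g (x true) (x false))
  simp only [Function.comp_apply, if_true, Bool.false_eq_true, if_false] at h1
  rw [h1]
  simp only [expect, piDist]
  rw [← (Equiv.boolArrowEquivProd α).symm.sum_comp]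
  simp [Fintype.sum_prod_type, Finset.mul_sum]
  rw [Finset.sum_comm]
  refine Finset.sum_congr rfl fun _ _ => Finset.sum_congr rfl fun _ _ => ?_
  ring

/-- Memorylessness: codebook letters and outputs of a block can be drawn as independent pairs, one
for each time. -/
lemma expect_piDist_compProd (d : ι → Dist α) (k : ι → α → Dist β) (f : (ι → α) → (ι → β) → ℝ) :
    (expect (piDist d) fun x => expect (piDist fun i => k i (x i)) fun y => f x y) =
      expect (piDist fun i => compProd (d i) (k i)) fun z =>
        f (fun i => (z i).1) (fun i => (z i).2) := by
  simp only [expect, piDist, compProd, Finset.mul_sum, Finset.prod_mul_distrib]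
  rw [← (Equiv.arrowProdEquivProdArrow ι (fun _ => α) (fun _ => β)).symm.sum_comp,
    Fintype.sum_prod_type]
  simp [Equiv.arrowProdEquivProdArrow, mul_assoc]

end Expectation

/-! ### Information densities and their moments. -/

section Information
variable {Ω A B C T : Type*} [Fintype Ω] [Fintype A] [Fintype B] [Fintype C] [Fintype T]

lemma law_nonneg (d : Dist Ω) (X : Ω → A) (a : A) : 0 ≤ law d.1 X a :=
  Finset.sum_nonneg fun ω _ => by split_ifs <;> simp [d.2.1 ω]

lemma law_pos (d : Dist Ω) (X : Ω → A) {ω : Ω} (h : 0 < d.1 ω) : 0 < law d.1 X (X ω) := by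
  classical
  refine Finset.sum_pos' (fun ω _ => ?_) ⟨ω, Finset.mem_univ _, by simpa using h⟩
  split_ifs <;> simp [d.2.1 ω]

lemma expect_ite_eq_law [DecidableEq A] (d : Dist Ω) (X : Ω → A) (a : A) (r : ℝ) :
    expect d (fun ω => if X ω = a then r else 0) = law d.1 X a * r := by
  simp only [expect, law, Finset.sum_mul]
  refine Finset.sum_congr rfl fun ω _ => ?_
  by_cases h : X ω = a <;> simp [h]

lemma sum_law_mul (d : Dist Ω) (X : Ω → A) (f : A → ℝ) :
    ∑ a, law d.1 X a * f a = expect d (fun ω => f (X ω)) := by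
  classical
  simp only [← expect_ite_eq_law, ← expect_sum]
  simp

/-- The quotient `p(a,b,c) p(c) / (p(a,c) p(b,c))`, whose logarithm is the conditional information
density. -/
def density (p : Ω → ℝ) (X : Ω → A) (Y : Ω → B) (Z : Ω → C) (a : A) (b : B) (c : C) : ℝ :=
  (law p (fun ω => (X ω, Y ω, Z ω)) (a, b, c) * law p Z c) /
    (law p (fun ω => (X ω, Z ω)) (a, c) * law p (fun ω => (Y ω, Z ω)) (b, c))

lemma density_nonneg (d : Dist Ω) (X : Ω → A) (Y : Ω → B) (Z : Ω → C) (a : A) (b : B) (c : C) :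
    0 ≤ density d.1 X Y Z a b c :=
  div_nonneg (mul_nonneg (law_nonneg _ _ _) (law_nonneg _ _ _))
    (mul_nonneg (law_nonneg _ _ _) (law_nonneg _ _ _))

lemma density_pos (d : Dist Ω) (X : Ω → A) (Y : Ω → B) (Z : Ω → C) {ω : Ω} (h : 0 < d.1 ω) :
    0 < density d.1 X Y Z (X ω) (Y ω) (Z ω) :=
  div_pos (mul_pos (law_pos d (fun ω => (X ω, Y ω, Z ω)) h) (law_pos d Z h))
    (mul_pos (law_pos d (fun ω => (X ω, Z ω)) h) (law_pos d (fun ω => (Y ω, Z ω)) h))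

lemma condMI_eq_expect (d : Dist Ω) (X : Ω → A) (Y : Ω → B) (Z : Ω → C) :
    condMI d.1 X Y Z =
      expect d fun ω => Real.logb 2 (density d.1 X Y Z (X ω) (Y ω) (Z ω)) := by
  rw [← sum_law_mul d (fun ω => (X ω, Y ω, Z ω))
    (fun x => Real.logb 2 (density d.1 X Y Z x.1 x.2.1 x.2.2))]
  simp only [Fintype.sum_prod_type, condMI, density]

/-- If `X` is replaced by a variable that is drawn from its conditional distribution given `Z`,
independently of `Y`, then the expectation of the density is at most `1`. -/
lemma expect_density_le_one (d : Dist Ω) (X : Ω → A) (Y : Ω → B) (Z : Ω → C) (k : C → Dist T)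
    (π : C → T → A)
    (h : ∀ g : A → C → ℝ, expect d (fun ω => g (X ω) (Z ω)) =
      expect d fun ω => expect (k (Z ω)) fun t => g (π (Z ω) t) (Z ω)) :
    expect d (fun ω => expect (k (Z ω)) fun t => density d.1 X Y Z (π (Z ω) t) (Y ω) (Z ω)) ≤ 1 := by
  classical
  -- Tested on indicators of points, `h` says that `π c` carries `k c` to the conditional law of `X`
  -- given `Z = c`.
  have hlaw : ∀ a c, law d.1 (fun ω => (X ω, Z ω)) (a, c) =
      law d.1 Z c * expect (k c) fun t => if π c t = a then 1 else 0 := by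
    intro a c
    have h1 := h fun a' c' => if (a', c') = (a, c) then 1 else 0
    rw [expect_ite_eq_law d (fun ω => (X ω, Z ω)) (a, c) 1, mul_one] at h1
    rw [h1, ← expect_ite_eq_law]
    refine expect_congr d fun ω => ?_
    by_cases hc : Z ω = c
    · simp [hc]
    · simp [hc]
  have hexp : ∀ b c, (expect (k c) fun t => density d.1 X Y Z (π c t) b c) =
      ∑ a, (expect (k c) fun t => if π c t = a then 1 else 0) * density d.1 X Y Z a b c := by
    intro b c
    simp only [mul_comm _ (density _ _ _ _ _ _ _), ← expect_mul_left]
    rw [← expect_sum]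
    simp
  simp only [hexp]
  rw [← sum_law_mul d (fun ω => (Y ω, Z ω))
    (fun x => ∑ a, (expect (k x.2) fun t => if π x.2 t = a then 1 else 0) *
      density d.1 X Y Z a x.1 x.2)]
  have hone : ∑ x : B × C, ∑ a, law d.1 (fun ω => (X ω, Y ω, Z ω)) (a, x.1, x.2) = 1 := by
    rw [Finset.sum_comm]
    have h1 := sum_law_mul d (fun ω => (X ω, Y ω, Z ω)) fun _ => 1
    simp only [mul_one, expect_const] at h1
    rw [← h1, Fintype.sum_prod_type]
  refine le_trans ?_ hone.le
  refine Finset.sum_le_sum fun x _ => ?_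
  obtain ⟨b, c⟩ := x
  rw [Finset.mul_sum]
  refine Finset.sum_le_sum fun a _ => ?_
  simp only [density]
  have hl := hlaw a c
  set κ := expect (k c) fun t => if π c t = a then (1 : ℝ) else 0
  have n1 := law_nonneg d (fun ω => (X ω, Y ω, Z ω)) (a, b, c)
  -- If a factor of the denominator vanishes, the left side is zero. Otherwise `p(a,c) = p(c) κ` and
  -- everything cancels.
  rcases (law_nonneg d (fun ω => (Y ω, Z ω)) (b, c)).eq_or_lt with hb | hb
  · rw [← hb, zero_mul]
    exact n1
  rcases (law_nonneg d (fun ω => (X ω, Z ω)) (a, c)).eq_or_lt with ha | ha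
  · rw [← ha, zero_mul, div_zero, mul_zero, mul_zero]
    exact n1
  rw [hl] at ha ⊢
  have h1 : law d.1 Z c ≠ 0 := fun h0 => by simp [h0] at ha
  have h2 : κ ≠ 0 := fun h0 => by simp [h0] at ha
  refine le_of_eq ?_
  field_simp

/-- An exponential tail bound: the exponential moment is below `1` for a suitable exponent. -/
lemma exists_expect_rpow_lt_one (d : Dist Ω) (l : Ω → ℝ) {γ : ℝ} (h : γ < expect d l) :
    ∃ s : ℝ, 0 < s ∧ expect d (fun ω => (2 : ℝ) ^ (s * (γ - l ω))) < 1 := by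
  -- At `s = 0` the moment equals one and has the negative derivative `log 2 * (γ - E l)`, so it is
  -- below one for some small `s > 0`.
  have hd : HasDerivAt (fun s : ℝ => expect d (fun ω => (2 : ℝ) ^ (s * (γ - l ω))))
      (expect d fun ω => Real.log 2 * (γ - l ω)) 0 := by
    unfold expect
    refine HasDerivAt.fun_sum fun ω _ => HasDerivAt.const_mul _ ?_
    have h1 := ((hasDerivAt_id (0 : ℝ)).mul_const (γ - l ω)).const_rpow (a := 2) (by norm_num)
    simpa [mul_comm] using h1
  have hneg : (expect d fun ω => Real.log 2 * (γ - l ω)) < 0 := by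
    rw [expect_mul_left]
    refine mul_neg_of_pos_of_neg (Real.log_pos (by norm_num)) ?_
    have h1 := expect_add d (fun ω => γ - l ω) l
    simp only [sub_add_cancel, expect_const] at h1
    linarith
  have ht := (hd.tendsto_slope_zero_right).eventually (gt_mem_nhds hneg)
  obtain ⟨s, hs, hs0⟩ := (ht.and self_mem_nhdsWithin).exists
  refine ⟨s, hs0, ?_⟩
  have hs0' : (0 : ℝ) < s := hs0
  simp only [zero_add, zero_mul, Real.rpow_zero, expect_const, smul_eq_mul] at hs
  have := (mul_neg_iff.1 hs)
  rcases this with h2 | h2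
  · linarith [h2.2]
  · linarith [inv_pos.2 hs0', h2.1]

end Information

/-! ### Disintegration of the single-letter law into kernels. -/

section Joint
variable {Q U₁ U₂ X₁ X₂ X₃ Y₁ Y₂ Y₃ : Type*} [Fintype Q] [Fintype U₁] [Fintype U₂]
  [Fintype X₁] [Fintype X₂] [Fintype X₃] [Fintype Y₁] [Fintype Y₂] [Fintype Y₃]

/-- A joint distribution is the product of a marginal and of a conditional distribution. -/
lemma exists_disintegration {X U : Type*} [Fintype X] [Fintype U] (d : Dist (X × U)) :
    ∃ (p : Dist U) (k : U → Dist X), ∀ x u, d.1 (x, u) = p.1 u * (k u).1 x := by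
  have hsum : ∑ u, ∑ x, d.1 (x, u) = 1 := by
    rw [Finset.sum_comm, ← d.2.2, Fintype.sum_prod_type]
  obtain ⟨x₀⟩ : Nonempty X := by
    by_contra hX
    rw [not_nonempty_iff] at hX
    simp at hsum
  classical
  -- An arbitrary conditional law, for the values `u` of marginal mass zero.
  let e : Dist X := ⟨fun x => if x = x₀ then 1 else 0, fun x => by dsimp; split_ifs <;> simp,
    by simp⟩
  refine ⟨⟨fun u => ∑ x, d.1 (x, u), fun u => Finset.sum_nonneg fun x _ => d.2.1 _, hsum⟩,
    fun u => if h : ∑ x, d.1 (x, u) = 0 then e else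
      ⟨fun x => d.1 (x, u) / ∑ x, d.1 (x, u),
        fun x => div_nonneg (d.2.1 _) (Finset.sum_nonneg fun x _ => d.2.1 _), by
          rw [← Finset.sum_div, div_self h]⟩, fun x u => ?_⟩
  by_cases h : ∑ x, d.1 (x, u) = 0
  · have := (Finset.sum_eq_zero_iff_of_nonneg fun x _ => d.2.1 (x, u)).1 h x (Finset.mem_univ _)
    simp only [h, zero_mul]
    exact this
  · simp only [h, dite_false]
    field_simp

lemma exists_disintegration_kernel {X U : Type*} [Fintype X] [Fintype U] (d : Q → Dist (X × U)) :
    ∃ (p : Q → Dist U) (k : Q → U → Dist X), ∀ q x u, (d q).1 (x, u) = (p q).1 u * (k q u).1 x := by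
  choose p k h using fun q => exists_disintegration (d q)
  exact ⟨p, k, h⟩

lemma sum_letters (f : Letters Q U₁ U₂ X₁ X₂ X₃ Y₁ Y₂ Y₃ → ℝ) :
    ∑ ω, f ω = ∑ q, ∑ u₁, ∑ x₁, ∑ u₂, ∑ x₂, ∑ x₃, ∑ y₁, ∑ y₂, ∑ y₃,
      f ⟨q, u₁, u₂, x₁, x₂, x₃, y₁, y₂, y₃⟩ := by
  let e : Q × U₁ × X₁ × U₂ × X₂ × X₃ × Y₁ × Y₂ × Y₃ ≃ Letters Q U₁ U₂ X₁ X₂ X₃ Y₁ Y₂ Y₃ :=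
    { toFun := fun (q, u₁, x₁, u₂, x₂, x₃, y₁, y₂, y₃) => ⟨q, u₁, u₂, x₁, x₂, x₃, y₁, y₂, y₃⟩
      invFun := fun ω => (ω.q, ω.u₁, ω.x₁, ω.u₂, ω.x₂, ω.x₃, ω.y₁, ω.y₂, ω.y₃)
      left_inv := fun _ => rfl
      right_inv := fun _ => rfl }
  rw [← e.sum_comp]
  simp only [Fintype.sum_prod_type]
  rfl

/-- The input law in terms of kernels: the factors `p(q)`, `p(u₁ | q)`, `p(x₁ | u₁, q)`,
`p(u₂ | q)`, `p(x₂ | u₂, q)` and `p(x₃ | u₁, u₂, q)`. -/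
structure Kernels (Q U₁ U₂ X₁ X₂ X₃ : Type*) [Fintype Q] [Fintype U₁] [Fintype U₂]
    [Fintype X₁] [Fintype X₂] [Fintype X₃] where
  q : Dist Q
  u₁ : Q → Dist U₁
  u₂ : Q → Dist U₂
  x₁ : Q → U₁ → Dist X₁
  x₂ : Q → U₂ → Dist X₂
  x₃ : Q → U₁ → U₂ → Dist X₃

/-- The expectation of a function of all single-letter random variables; `a`, `b`, `c` and `y` are
the values of `(u₁, x₁)`, `(u₂, x₂)`, `x₃` and `(y₁, y₂, y₃)`. -/
def Kernels.E (κ : Kernels Q U₁ U₂ X₁ X₂ X₃) (W : Channel X₁ X₂ X₃ Y₁ Y₂ Y₃)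
    (f : Q → U₁ × X₁ → U₂ × X₂ → X₃ → Y₁ × Y₂ × Y₃ → ℝ) : ℝ :=
  expect κ.q fun q => expect (compProd (κ.u₁ q) (κ.x₁ q)) fun a =>
    expect (compProd (κ.u₂ q) (κ.x₂ q)) fun b => expect (κ.x₃ q a.1 b.1) fun c =>
      expect (W a.2 b.2 c) fun y => f q a b c y

/-- The distribution `d` of the single-letter random variables is generated by the kernels `κ` and
the channel `W`. -/
def Kernels.Generates (κ : Kernels Q U₁ U₂ X₁ X₂ X₃) (W : Channel X₁ X₂ X₃ Y₁ Y₂ Y₃)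
    (d : Dist (Letters Q U₁ U₂ X₁ X₂ X₃ Y₁ Y₂ Y₃)) : Prop :=
  ∀ f : Letters Q U₁ U₂ X₁ X₂ X₃ Y₁ Y₂ Y₃ → ℝ, expect d f =
    κ.E W fun q a b c y => f ⟨q, a.1, b.1, a.2, b.2, c, y.1, y.2.1, y.2.2⟩

/-- The codebook needs many letters `x` for the same `u`, so each `p(x, u | q)` has to be split into
`p(u | q)` and `p(x | u, q)`. -/
lemma exists_kernels (P : InputLaw Q U₁ U₂ X₁ X₂ X₃) (W : Channel X₁ X₂ X₃ Y₁ Y₂ Y₃) :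
    ∃ (κ : Kernels Q U₁ U₂ X₁ X₂ X₃) (d : Dist (Letters Q U₁ U₂ X₁ X₂ X₃ Y₁ Y₂ Y₃)),
      d.1 = P.joint W ∧ κ.Generates W d := by
  obtain ⟨p₁, k₁, h₁⟩ := exists_disintegration_kernel P.xu₁
  obtain ⟨p₂, k₂, h₂⟩ := exists_disintegration_kernel P.xu₂
  let κ : Kernels Q U₁ U₂ X₁ X₂ X₃ := ⟨P.q, p₁, p₂, k₁, k₂, fun q u₁ u₂ => P.x₃ u₁ u₂ q⟩
  have h : ∀ f : Letters Q U₁ U₂ X₁ X₂ X₃ Y₁ Y₂ Y₃ → ℝ, ∑ ω, P.joint W ω * f ω =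
      κ.E W fun q a b c y => f ⟨q, a.1, b.1, a.2, b.2, c, y.1, y.2.1, y.2.2⟩ := by
    intro f
    simp only [Kernels.E, expect_compProd]
    simp only [sum_letters, expect, Finset.mul_sum, Fintype.sum_prod_type, InputLaw.joint, h₁, h₂,
      κ]
    iterate 9 refine Finset.sum_congr rfl fun _ _ => ?_
    ring
  refine ⟨κ, ⟨P.joint W, fun ω => ?_, ?_⟩, rfl, h⟩
  · exact mul_nonneg (mul_nonneg (mul_nonneg (mul_nonneg (P.q.2.1 _) ((P.xu₁ _).2.1 _))
      ((P.xu₂ _).2.1 _)) ((P.x₃ _ _ _).2.1 _)) ((W _ _ _).2.1 _)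
  · have h1 := h fun _ => 1
    simpa [Kernels.E] using h1

end Joint

/-! ### Mean at most one of the densities of wrong candidates. -/

section Packing
variable {Q U₁ U₂ X₁ X₂ X₃ Y₁ Y₂ Y₃ B : Type*} [Fintype Q] [Fintype U₁] [Fintype U₂]
  [Fintype X₁] [Fintype X₂] [Fintype X₃] [Fintype Y₁] [Fintype Y₂] [Fintype Y₃] [Fintype B]
  {κ : Kernels Q U₁ U₂ X₁ X₂ X₃} {W : Channel X₁ X₂ X₃ Y₁ Y₂ Y₃}
  {d : Dist (Letters Q U₁ U₂ X₁ X₂ X₃ Y₁ Y₂ Y₃)}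

namespace Kernels.Generates

/-- A fresh sub-message of source `1` at the relay. -/
lemma relay₁ (h : κ.Generates W d) (φ : Y₁ × Y₂ × Y₃ → B) :
    (κ.E W fun q a b c y => expect (κ.x₁ q a.1) fun t =>
      density d.1 (fun ω => ω.x₁) (fun ω => φ (ω.y₁, ω.y₂, ω.y₃))
        (fun ω => (ω.u₁, ω.x₂, ω.x₃, ω.q)) t (φ y) (a.1, b.2, c, q)) ≤ 1 := by
  have h1 := expect_density_le_one d (fun ω => ω.x₁) (fun ω => φ (ω.y₁, ω.y₂, ω.y₃))
    (fun ω => (ω.u₁, ω.x₂, ω.x₃, ω.q)) (fun z => κ.x₁ z.2.2.2 z.1) (fun _ t => t) (fun g => by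
      simp only [h _, Kernels.E, expect_compProd, expect_const]
      -- With the output integrated out, what remains is that `x₁` is independent of `x₂`, `x₃`
      -- given `u₁`, `q`. Exchanging the order of integration shows it.
      refine expect_congr _ fun q => expect_congr _ fun u₁ => ?_
      rw [expect_comm]
      refine expect_congr _ fun u₂ => ?_
      rw [expect_comm]
      refine expect_congr _ fun x₂ => ?_
      rw [expect_comm])
  rwa [h _] at h1

/-- A fresh sub-message of source `2` at the relay. -/
lemma relay₂ (h : κ.Generates W d) (φ : Y₁ × Y₂ × Y₃ → B) :
    (κ.E W fun q a b c y => expect (κ.x₂ q b.1) fun t =>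
      density d.1 (fun ω => ω.x₂) (fun ω => φ (ω.y₁, ω.y₂, ω.y₃))
        (fun ω => (ω.u₂, ω.x₁, ω.x₃, ω.q)) t (φ y) (b.1, a.2, c, q)) ≤ 1 := by
  have h1 := expect_density_le_one d (fun ω => ω.x₂) (fun ω => φ (ω.y₁, ω.y₂, ω.y₃))
    (fun ω => (ω.u₂, ω.x₁, ω.x₃, ω.q)) (fun z => κ.x₂ z.2.2.2 z.1) (fun _ t => t) (fun g => by
      simp only [h _, Kernels.E, expect_compProd, expect_const]
      refine expect_congr _ fun q => expect_congr _ fun u₁ => expect_congr _ fun x₁ =>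
        expect_congr _ fun u₂ => ?_
      rw [expect_comm])
  rwa [h _] at h1

/-- Fresh sub-messages of both sources at the relay. -/
lemma relay₁₂ (h : κ.Generates W d) (φ : Y₁ × Y₂ × Y₃ → B) :
    (κ.E W fun q a b c y => expect (κ.x₁ q a.1) fun t₁ => expect (κ.x₂ q b.1) fun t₂ =>
      density d.1 (fun ω => (ω.x₁, ω.x₂)) (fun ω => φ (ω.y₁, ω.y₂, ω.y₃))
        (fun ω => (ω.u₁, ω.u₂, ω.x₃, ω.q)) (t₁, t₂) (φ y) (a.1, b.1, c, q)) ≤ 1 := by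
  have h1 := expect_density_le_one d (fun ω => (ω.x₁, ω.x₂)) (fun ω => φ (ω.y₁, ω.y₂, ω.y₃))
    (fun ω => (ω.u₁, ω.u₂, ω.x₃, ω.q))
    (fun z => compProd (κ.x₁ z.2.2.2 z.1) fun _ => κ.x₂ z.2.2.2 z.2.1) (fun _ t => t) (fun g => by
      simp only [h _, Kernels.E, expect_compProd, expect_const]
      refine expect_congr _ fun q => expect_congr _ fun u₁ => ?_
      rw [expect_comm]
      refine expect_congr _ fun u₂ => ?_
      rw [expect_comm (κ.x₃ q u₁ u₂)]
      refine expect_congr _ fun x₁ => ?_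
      rw [expect_comm])
  rw [h _] at h1
  simpa only [expect_compProd] using h1

/-- A wrong sub-message of the relay at a receiver. -/
lemma recv₃ (h : κ.Generates W d) (φ : Y₁ × Y₂ × Y₃ → B) :
    (κ.E W fun q a b _ y => expect (κ.x₃ q a.1 b.1) fun t =>
      density d.1 (fun ω => ω.x₃) (fun ω => φ (ω.y₁, ω.y₂, ω.y₃))
        (fun ω => (ω.x₁, ω.x₂, ω.u₁, ω.u₂, ω.q)) t (φ y) (a.2, b.2, a.1, b.1, q)) ≤ 1 := by
  have h1 := expect_density_le_one d (fun ω => ω.x₃) (fun ω => φ (ω.y₁, ω.y₂, ω.y₃))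
    (fun ω => (ω.x₁, ω.x₂, ω.u₁, ω.u₂, ω.q)) (fun z => κ.x₃ z.2.2.2.2 z.2.2.1 z.2.2.2.1)
    (fun _ t => t) (fun g => by
      simp only [h _, Kernels.E, expect_compProd, expect_const])
  rwa [h _] at h1

/-- A wrong sub-message of source `1` at a receiver. -/
lemma recv₁₃ (h : κ.Generates W d) (φ : Y₁ × Y₂ × Y₃ → B) :
    (κ.E W fun q _ b _ y => expect (compProd (κ.u₁ q) (κ.x₁ q)) fun a' =>
      expect (κ.x₃ q a'.1 b.1) fun c' =>
      density d.1 (fun ω => (ω.x₁, ω.x₃)) (fun ω => φ (ω.y₁, ω.y₂, ω.y₃))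
        (fun ω => (ω.x₂, ω.u₂, ω.q)) (a'.2, c') (φ y) (b.2, b.1, q)) ≤ 1 := by
  have h1 := expect_density_le_one d (fun ω => (ω.x₁, ω.x₃)) (fun ω => φ (ω.y₁, ω.y₂, ω.y₃))
    (fun ω => (ω.x₂, ω.u₂, ω.q))
    (fun z => compProd (compProd (κ.u₁ z.2.2) (κ.x₁ z.2.2)) fun a => κ.x₃ z.2.2 a.1 z.2.1)
    (fun _ t => (t.1.2, t.2)) (fun g => by
      simp only [h _, Kernels.E, expect_compProd _ fun a : U₁ × X₁ => κ.x₃ _ a.1 _, expect_const]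
      exact expect_congr _ fun q => expect_comm _ _ _)
  rw [h _] at h1
  simpa only [expect_compProd _ fun a : U₁ × X₁ => κ.x₃ _ a.1 _] using h1

/-- A wrong sub-message of source `2` at a receiver. -/
lemma recv₂₃ (h : κ.Generates W d) (φ : Y₁ × Y₂ × Y₃ → B) :
    (κ.E W fun q a _ _ y => expect (compProd (κ.u₂ q) (κ.x₂ q)) fun b' =>
      expect (κ.x₃ q a.1 b'.1) fun c' =>
      density d.1 (fun ω => (ω.x₂, ω.x₃)) (fun ω => φ (ω.y₁, ω.y₂, ω.y₃))
        (fun ω => (ω.x₁, ω.u₁, ω.q)) (b'.2, c') (φ y) (a.2, a.1, q)) ≤ 1 := by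
  have h1 := expect_density_le_one d (fun ω => (ω.x₂, ω.x₃)) (fun ω => φ (ω.y₁, ω.y₂, ω.y₃))
    (fun ω => (ω.x₁, ω.u₁, ω.q))
    (fun z => compProd (compProd (κ.u₂ z.2.2) (κ.x₂ z.2.2)) fun b => κ.x₃ z.2.2 z.2.1 b.1)
    (fun _ t => (t.1.2, t.2)) (fun g => by
      simp only [h _, Kernels.E, expect_compProd _ fun b : U₂ × X₂ => κ.x₃ _ _ b.1, expect_const])
  rw [h _] at h1
  simpa only [expect_compProd _ fun b : U₂ × X₂ => κ.x₃ _ _ b.1] using h1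

/-- Wrong sub-messages of both sources at a receiver. -/
lemma recv₁₂₃ (h : κ.Generates W d) (φ : Y₁ × Y₂ × Y₃ → B) :
    (κ.E W fun q _ _ _ y => expect (compProd (κ.u₁ q) (κ.x₁ q)) fun a' =>
      expect (compProd (κ.u₂ q) (κ.x₂ q)) fun b' => expect (κ.x₃ q a'.1 b'.1) fun c' =>
      density d.1 (fun ω => (ω.x₁, ω.x₂, ω.x₃)) (fun ω => φ (ω.y₁, ω.y₂, ω.y₃))
        (fun ω => ω.q) (a'.2, b'.2, c') (φ y) q) ≤ 1 := by
  have h1 := expect_density_le_one d (fun ω => (ω.x₁, ω.x₂, ω.x₃))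
    (fun ω => φ (ω.y₁, ω.y₂, ω.y₃)) (fun ω => ω.q)
    (fun q => compProd (compProd (κ.u₁ q) (κ.x₁ q)) fun a =>
      compProd (compProd (κ.u₂ q) (κ.x₂ q)) fun b => κ.x₃ q a.1 b.1)
    (fun _ t => (t.1.2, t.2.1.2, t.2.2)) (fun g => by
      simp only [h _, Kernels.E, expect_const]
      refine expect_congr _ fun q => ?_
      rw [expect_compProd _ fun a : U₁ × X₁ => compProd _ _]
      refine expect_congr _ fun a => ?_
      rw [expect_compProd _ fun b : U₂ × X₂ => κ.x₃ _ _ b.1])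
  have h2 : ∀ q (f : X₁ → X₂ → X₃ → ℝ),
      (expect (compProd (compProd (κ.u₁ q) (κ.x₁ q)) fun a =>
        compProd (compProd (κ.u₂ q) (κ.x₂ q)) fun b => κ.x₃ q a.1 b.1) fun t =>
          f t.1.2 t.2.1.2 t.2.2) =
      expect (compProd (κ.u₁ q) (κ.x₁ q)) fun a => expect (compProd (κ.u₂ q) (κ.x₂ q)) fun b =>
        expect (κ.x₃ q a.1 b.1) fun c => f a.2 b.2 c := fun q f =>
    (expect_compProd _ _ _).trans (expect_congr _ fun a => expect_compProd _ _ _)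
  rw [h _] at h1
  refine le_trans (le_of_eq ?_) h1
  unfold Kernels.E
  refine expect_congr _ fun q => expect_congr _ fun _ => expect_congr _ fun _ =>
    expect_congr _ fun _ => expect_congr _ fun y => ?_
  exact (h2 q fun x₁ x₂ x₃ => density d.1 (fun ω => (ω.x₁, ω.x₂, ω.x₃))
        (fun ω => φ (ω.y₁, ω.y₂, ω.y₃)) (fun ω => ω.q) (x₁, x₂, x₃) (φ y) q).symm

end Kernels.Generates

end Packing

/-! ### Exchanging an independent draw with a chain of dependent ones. -/

section Commutation
variable {α β γ δ : Type*} [Fintype α] [Fintype β] [Fintype γ] [Fintype δ]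

lemma expect_comm₂ (d : Dist α) (e : Dist β) (k : β → Dist γ) (f : α → β → γ → ℝ) :
    (expect d fun a => expect e fun b => expect (k b) fun c => f a b c) =
      expect e fun b => expect (k b) fun c => expect d fun a => f a b c :=
  (expect_comm _ _ _).trans (expect_congr _ fun _ => expect_comm _ _ _)

lemma expect_comm₃ (d : Dist α) (e : Dist β) (k : β → Dist γ) (l : β → γ → Dist δ)
    (f : α → β → γ → δ → ℝ) :
    (expect d fun a => expect e fun b => expect (k b) fun c => expect (l b c) fun x => f a b c x) =
      expect e fun b => expect (k b) fun c => expect (l b c) fun x => expect d fun a =>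
        f a b c x :=
  (expect_comm _ _ _).trans (expect_congr _ fun _ => expect_comm₂ _ _ _ _)

end Commutation

/-! ### Random codeword letters of one source. -/

section Rows
variable {U X A : Type*} [Fintype U] [Fintype X] [Fintype A] [DecidableEq A]

/-- The codeword letters of a source: for each previous sub-message a letter `u`, and for each pair
of a previous and a fresh sub-message a letter `x`. -/
def rowsDist (A : Type*) [Fintype A] [DecidableEq A] (p : Dist U) (k : U → Dist X) :
    Dist (A → U × (A → X)) :=
  piDist fun _ => compProd p fun u => piDist fun _ => k u

/-- The pair of letters that is sent for the previous sub-message `a` and the fresh one `f`. -/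
def entry (r : A → U × (A → X)) (a f : A) : U × X := ((r a).1, (r a).2 f)

lemma expect_rows_entry (p : Dist U) (k : U → Dist X) (a f : A) (g : U × X → ℝ) :
    expect (rowsDist A p k) (fun r => g (entry r a f)) = expect (compProd p k) g := by
  refine (expect_piDist_apply (fun _ => compProd p fun u => piDist fun _ : A => k u) a
    (fun e => g (e.1, e.2 f))).trans ?_
  rw [expect_compProd, expect_compProd]
  exact expect_congr _ fun u => expect_piDist_apply (fun _ : A => k u) f fun x => g (u, x)

/-- Two fresh sub-messages with the same predecessor share `u`, and their letters `x` are
independent only given `u`. This is the situation at the relay. -/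
lemma expect_rows_fresh (p : Dist U) (k : U → Dist X) (a : A) {f f' : A} (hf : f ≠ f')
    (g : U × X → X → ℝ) :
    expect (rowsDist A p k) (fun r => g (entry r a f) ((r a).2 f')) =
      expect (compProd p k) fun e => expect (k e.1) fun x => g e x := by
  refine (expect_piDist_apply (fun _ => compProd p fun u => piDist fun _ : A => k u) a
    (fun e => g (e.1, e.2 f) (e.2 f'))).trans ?_
  rw [expect_compProd, expect_compProd]
  exact expect_congr _ fun u =>
    expect_piDist_apply₂ (fun _ : A => k u) hf fun x x' => g (u, x) x'

/-- Rows of distinct previous sub-messages are independent, so the whole pair `(u, x)` is renewed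
although `f` stays the same. This is the situation in backward decoding. -/
lemma expect_rows_entry₂ (p : Dist U) (k : U → Dist X) {a a' : A} (ha : a ≠ a') (f : A)
    (g : U × X → U × X → ℝ) :
    expect (rowsDist A p k) (fun r => g (entry r a f) (entry r a' f)) =
      expect (compProd p k) fun e => expect (compProd p k) fun e' => g e e' := by
  refine (expect_piDist_apply₂ (fun _ => compProd p fun u => piDist fun _ : A => k u) ha
    (fun e e' => g (e.1, e.2 f) (e'.1, e'.2 f))).trans ?_
  rw [expect_compProd, expect_compProd]
  refine expect_congr _ fun u => (expect_piDist_apply (fun _ : A => k u) f fun x =>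
    expect (compProd p fun u => piDist fun _ : A => k u) fun e' => g (u, x) (e'.1, e'.2 f)).trans ?_
  refine expect_congr _ fun x => ?_
  rw [expect_compProd, expect_compProd]
  exact expect_congr _ fun u' => expect_piDist_apply (fun _ : A => k u') f fun x' => g _ (u', x')

end Rows

/-! ### Joint law of the outputs with the letters of true and wrong candidates. -/

section Codebook
variable {Q U₁ U₂ X₁ X₂ X₃ Y₁ Y₂ Y₃ A₁ A₂ A₃ : Type*} [Fintype Q] [Fintype U₁] [Fintype U₂]
  [Fintype X₁] [Fintype X₂] [Fintype X₃] [Fintype Y₁] [Fintype Y₂] [Fintype Y₃]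
  [Fintype A₁] [Fintype A₂] [Fintype A₃] [DecidableEq A₁] [DecidableEq A₂] [DecidableEq A₃]

/-- One letter of every codeword: the time-sharing letter, the letters of the two sources and the
letters of the relay. -/
abbrev LetterBook (Q U₁ U₂ X₁ X₂ X₃ A₁ A₂ A₃ : Type*) :=
  Q × (A₁ → U₁ × (A₁ → X₁)) × (A₂ → U₂ × (A₂ → X₂)) × (A₁ × A₂ × A₃ → X₃)

namespace Kernels
variable (κ : Kernels Q U₁ U₂ X₁ X₂ X₃) (W : Channel X₁ X₂ X₃ Y₁ Y₂ Y₃)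

/-- The distribution of one letter of a random codebook. -/
def bookDist (A₁ A₂ A₃ : Type*) [Fintype A₁] [Fintype A₂] [Fintype A₃] [DecidableEq A₁]
    [DecidableEq A₂] [DecidableEq A₃] : Dist (LetterBook Q U₁ U₂ X₁ X₂ X₃ A₁ A₂ A₃) :=
  compProd κ.q fun q => compProd (rowsDist A₁ (κ.u₁ q) (κ.x₁ q)) fun r₁ =>
    compProd (rowsDist A₂ (κ.u₂ q) (κ.x₂ q)) fun r₂ =>
      piDist fun a : A₁ × A₂ × A₃ => κ.x₃ q (r₁ a.1).1 (r₂ a.2.1).1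

/-- The distribution of the outputs when the previous sub-messages `a₁`, `a₂`, the fresh ones
`f₁`, `f₂` and the sub-message `a₃` of the relay are sent. -/
def outDist (a₁ f₁ : A₁) (a₂ f₂ : A₂) (a₃ : A₃) (L : LetterBook Q U₁ U₂ X₁ X₂ X₃ A₁ A₂ A₃) :
    Dist (Y₁ × Y₂ × Y₃) :=
  W ((L.2.1 a₁).2 f₁) ((L.2.2.1 a₂).2 f₂) (L.2.2.2 (a₁, a₂, a₃))

variable (a₁ a₁' f₁ f₁' : A₁) (a₂ a₂' f₂ f₂' : A₂) (a₃ a₃' : A₃)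

/-- The joint distribution of one letter of a random codebook and of the outputs. -/
def transDist : Dist (LetterBook Q U₁ U₂ X₁ X₂ X₃ A₁ A₂ A₃ × (Y₁ × Y₂ × Y₃)) :=
  compProd (κ.bookDist A₁ A₂ A₃) (outDist W a₁ f₁ a₂ f₂ a₃)

lemma expect_transDist (f : LetterBook Q U₁ U₂ X₁ X₂ X₃ A₁ A₂ A₃ × (Y₁ × Y₂ × Y₃) → ℝ) :
    expect (κ.transDist W a₁ f₁ a₂ f₂ a₃) f =
      expect κ.q fun q => expect (rowsDist A₁ (κ.u₁ q) (κ.x₁ q)) fun r₁ =>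
      expect (rowsDist A₂ (κ.u₂ q) (κ.x₂ q)) fun r₂ =>
      expect (piDist fun a : A₁ × A₂ × A₃ => κ.x₃ q (r₁ a.1).1 (r₂ a.2.1).1) fun t =>
      expect (W (entry r₁ a₁ f₁).2 (entry r₂ a₂ f₂).2 (t (a₁, a₂, a₃))) fun y =>
        f ((q, r₁, r₂, t), y) := by
  simp only [transDist, bookDist, expect_compProd]
  rfl

/-- Each table is integrated down to the entry in use: the relay's table first, since its law
depends on the rows, then the rows of source `2` and of source `1`. -/
lemma expect_transDist_correct (F : Q → U₁ × X₁ → U₂ × X₂ → X₃ → Y₁ × Y₂ × Y₃ → ℝ) :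
    (expect (κ.transDist W a₁ f₁ a₂ f₂ a₃) fun z => F z.1.1 (entry z.1.2.1 a₁ f₁)
      (entry z.1.2.2.1 a₂ f₂) (z.1.2.2.2 (a₁, a₂, a₃)) z.2) = κ.E W F := by
  rw [expect_transDist]
  exact expect_congr _ fun q => (expect_congr _ fun r₁ => (expect_congr _ fun r₂ =>
    expect_piDist_apply _ (a₁, a₂, a₃) fun c =>
      expect (W (entry r₁ a₁ f₁).2 (entry r₂ a₂ f₂).2 c) fun y =>
        F q (entry r₁ a₁ f₁) (entry r₂ a₂ f₂) c y).trans
    (expect_rows_entry _ _ a₂ f₂ fun b => expect (κ.x₃ q (entry r₁ a₁ f₁).1 b.1) fun c =>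
      expect (W (entry r₁ a₁ f₁).2 b.2 c) fun y => F q (entry r₁ a₁ f₁) b c y)).trans
    (expect_rows_entry _ _ a₁ f₁ fun a => expect (compProd (κ.u₂ q) (κ.x₂ q)) fun b =>
      expect (κ.x₃ q a.1 b.1) fun c => expect (W a.2 b.2 c) fun y => F q a b c y)

variable {f₁ f₁' f₂ f₂'} in
lemma expect_transDist_relay₁ (h : f₁ ≠ f₁')
    (F : Q → U₁ × X₁ → U₂ × X₂ → X₃ → Y₁ × Y₂ × Y₃ → X₁ → ℝ) :
    (expect (κ.transDist W a₁ f₁ a₂ f₂ a₃) fun z => F z.1.1 (entry z.1.2.1 a₁ f₁)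
      (entry z.1.2.2.1 a₂ f₂) (z.1.2.2.2 (a₁, a₂, a₃)) z.2 ((z.1.2.1 a₁).2 f₁')) =
      κ.E W fun q a b c y => expect (κ.x₁ q a.1) fun t => F q a b c y t := by
  rw [expect_transDist]
  exact expect_congr _ fun q => ((expect_congr _ fun r₁ => (expect_congr _ fun r₂ =>
    expect_piDist_apply _ (a₁, a₂, a₃) fun c =>
      expect (W (entry r₁ a₁ f₁).2 (entry r₂ a₂ f₂).2 c) fun y =>
        F q (entry r₁ a₁ f₁) (entry r₂ a₂ f₂) c y ((r₁ a₁).2 f₁')).trans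
    (expect_rows_entry _ _ a₂ f₂ fun b => expect (κ.x₃ q (entry r₁ a₁ f₁).1 b.1) fun c =>
      expect (W (entry r₁ a₁ f₁).2 b.2 c) fun y =>
        F q (entry r₁ a₁ f₁) b c y ((r₁ a₁).2 f₁'))).trans
    (expect_rows_fresh _ _ a₁ h fun a t => expect (compProd (κ.u₂ q) (κ.x₂ q)) fun b =>
      expect (κ.x₃ q a.1 b.1) fun c => expect (W a.2 b.2 c) fun y => F q a b c y t)).trans
    (expect_congr _ fun a => expect_comm₃ _ _ _ _ _)

variable {f₁ f₁' f₂ f₂'} in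
lemma expect_transDist_relay₂ (h : f₂ ≠ f₂')
    (F : Q → U₁ × X₁ → U₂ × X₂ → X₃ → Y₁ × Y₂ × Y₃ → X₂ → ℝ) :
    (expect (κ.transDist W a₁ f₁ a₂ f₂ a₃) fun z => F z.1.1 (entry z.1.2.1 a₁ f₁)
      (entry z.1.2.2.1 a₂ f₂) (z.1.2.2.2 (a₁, a₂, a₃)) z.2 ((z.1.2.2.1 a₂).2 f₂')) =
      κ.E W fun q a b c y => expect (κ.x₂ q b.1) fun t => F q a b c y t := by
  rw [expect_transDist]
  exact expect_congr _ fun q => ((expect_congr _ fun r₁ => (expect_congr _ fun r₂ =>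
    expect_piDist_apply _ (a₁, a₂, a₃) fun c =>
      expect (W (entry r₁ a₁ f₁).2 (entry r₂ a₂ f₂).2 c) fun y =>
        F q (entry r₁ a₁ f₁) (entry r₂ a₂ f₂) c y ((r₂ a₂).2 f₂')).trans
    (expect_rows_fresh _ _ a₂ h fun b t => expect (κ.x₃ q (entry r₁ a₁ f₁).1 b.1) fun c =>
      expect (W (entry r₁ a₁ f₁).2 b.2 c) fun y => F q (entry r₁ a₁ f₁) b c y t)).trans
    (expect_rows_entry _ _ a₁ f₁ fun a => expect (compProd (κ.u₂ q) (κ.x₂ q)) fun b =>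
      expect (κ.x₂ q b.1) fun t => expect (κ.x₃ q a.1 b.1) fun c =>
        expect (W a.2 b.2 c) fun y => F q a b c y t)).trans
    (expect_congr _ fun a => expect_congr _ fun b => expect_comm₂ _ _ _ _)

variable {f₁ f₁' f₂ f₂'} in
lemma expect_transDist_relay₁₂ (h₁ : f₁ ≠ f₁') (h₂ : f₂ ≠ f₂')
    (F : Q → U₁ × X₁ → U₂ × X₂ → X₃ → Y₁ × Y₂ × Y₃ → X₁ → X₂ → ℝ) :
    (expect (κ.transDist W a₁ f₁ a₂ f₂ a₃) fun z => F z.1.1 (entry z.1.2.1 a₁ f₁)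
      (entry z.1.2.2.1 a₂ f₂) (z.1.2.2.2 (a₁, a₂, a₃)) z.2 ((z.1.2.1 a₁).2 f₁')
      ((z.1.2.2.1 a₂).2 f₂')) =
      κ.E W fun q a b c y => expect (κ.x₁ q a.1) fun t => expect (κ.x₂ q b.1) fun s =>
        F q a b c y t s := by
  rw [expect_transDist]
  exact expect_congr _ fun q => ((expect_congr _ fun r₁ => (expect_congr _ fun r₂ =>
    expect_piDist_apply _ (a₁, a₂, a₃) fun c =>
      expect (W (entry r₁ a₁ f₁).2 (entry r₂ a₂ f₂).2 c) fun y =>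
        F q (entry r₁ a₁ f₁) (entry r₂ a₂ f₂) c y ((r₁ a₁).2 f₁') ((r₂ a₂).2 f₂')).trans
    (expect_rows_fresh _ _ a₂ h₂ fun b s => expect (κ.x₃ q (entry r₁ a₁ f₁).1 b.1) fun c =>
      expect (W (entry r₁ a₁ f₁).2 b.2 c) fun y =>
        F q (entry r₁ a₁ f₁) b c y ((r₁ a₁).2 f₁') s)).trans
    (expect_rows_fresh _ _ a₁ h₁ fun a t => expect (compProd (κ.u₂ q) (κ.x₂ q)) fun b =>
      expect (κ.x₂ q b.1) fun s => expect (κ.x₃ q a.1 b.1) fun c =>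
        expect (W a.2 b.2 c) fun y => F q a b c y t s)).trans
    (expect_congr _ fun a => (expect_congr _ fun t => expect_congr _ fun b =>
      expect_comm₂ _ _ _ _).trans (expect_comm₃ _ _ _ _ _))

-- The wrong relay letter is a second independent draw from the same kernel, as both triples share
-- the letters `u₁`, `u₂`.
variable {a₃ a₃'} in
lemma expect_transDist_recv₃ (h : a₃ ≠ a₃')
    (F : Q → U₁ × X₁ → U₂ × X₂ → X₃ → Y₁ × Y₂ × Y₃ → X₃ → ℝ) :
    (expect (κ.transDist W a₁ f₁ a₂ f₂ a₃) fun z => F z.1.1 (entry z.1.2.1 a₁ f₁)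
      (entry z.1.2.2.1 a₂ f₂) (z.1.2.2.2 (a₁, a₂, a₃)) z.2 (z.1.2.2.2 (a₁, a₂, a₃'))) =
      κ.E W fun q a b c y => expect (κ.x₃ q a.1 b.1) fun t => F q a b c y t := by
  rw [expect_transDist]
  have h' : (a₁, a₂, a₃) ≠ (a₁, a₂, a₃') := by simpa using h
  exact expect_congr _ fun q => ((expect_congr _ fun r₁ => (expect_congr _ fun r₂ =>
    expect_piDist_apply₂ _ h' fun c c' =>
      expect (W (entry r₁ a₁ f₁).2 (entry r₂ a₂ f₂).2 c) fun y =>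
        F q (entry r₁ a₁ f₁) (entry r₂ a₂ f₂) c y c').trans
    (expect_rows_entry _ _ a₂ f₂ fun b => expect (κ.x₃ q (entry r₁ a₁ f₁).1 b.1) fun c =>
      expect (κ.x₃ q (entry r₁ a₁ f₁).1 b.1) fun c' =>
      expect (W (entry r₁ a₁ f₁).2 b.2 c) fun y => F q (entry r₁ a₁ f₁) b c y c')).trans
    (expect_rows_entry _ _ a₁ f₁ fun a => expect (compProd (κ.u₂ q) (κ.x₂ q)) fun b =>
      expect (κ.x₃ q a.1 b.1) fun c => expect (κ.x₃ q a.1 b.1) fun c' =>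
      expect (W a.2 b.2 c) fun y => F q a b c y c')).trans
    (expect_congr _ fun a => expect_congr _ fun b => expect_congr _ fun c => expect_comm _ _ _)

-- The two triples already differ in the first index, so the relay letters are conditionally
-- independent without any assumption on `a₃'`. This is why `a₃'` may equal `a₃`.
variable {a₁ a₁'} in
lemma expect_transDist_recv₁₃ (h : a₁ ≠ a₁')
    (F : Q → U₁ × X₁ → U₂ × X₂ → X₃ → Y₁ × Y₂ × Y₃ → U₁ × X₁ → X₃ → ℝ) :
    (expect (κ.transDist W a₁ f₁ a₂ f₂ a₃) fun z => F z.1.1 (entry z.1.2.1 a₁ f₁)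
      (entry z.1.2.2.1 a₂ f₂) (z.1.2.2.2 (a₁, a₂, a₃)) z.2 (entry z.1.2.1 a₁' f₁)
      (z.1.2.2.2 (a₁', a₂, a₃'))) =
      κ.E W fun q a b c y => expect (compProd (κ.u₁ q) (κ.x₁ q)) fun a' =>
        expect (κ.x₃ q a'.1 b.1) fun c' => F q a b c y a' c' := by
  rw [expect_transDist]
  have h' : (a₁, a₂, a₃) ≠ (a₁', a₂, a₃') := fun e => h (Prod.ext_iff.1 e).1
  exact expect_congr _ fun q => ((expect_congr _ fun r₁ => (expect_congr _ fun r₂ =>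
    expect_piDist_apply₂ _ h' fun c c' =>
      expect (W (entry r₁ a₁ f₁).2 (entry r₂ a₂ f₂).2 c) fun y =>
        F q (entry r₁ a₁ f₁) (entry r₂ a₂ f₂) c y (entry r₁ a₁' f₁) c').trans
    (expect_rows_entry _ _ a₂ f₂ fun b => expect (κ.x₃ q (entry r₁ a₁ f₁).1 b.1) fun c =>
      expect (κ.x₃ q (entry r₁ a₁' f₁).1 b.1) fun c' =>
      expect (W (entry r₁ a₁ f₁).2 b.2 c) fun y =>
        F q (entry r₁ a₁ f₁) b c y (entry r₁ a₁' f₁) c')).trans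
    (expect_rows_entry₂ _ _ h f₁ fun a a' => expect (compProd (κ.u₂ q) (κ.x₂ q)) fun b =>
      expect (κ.x₃ q a.1 b.1) fun c => expect (κ.x₃ q a'.1 b.1) fun c' =>
      expect (W a.2 b.2 c) fun y => F q a b c y a' c')).trans
    (expect_congr _ fun a => (expect_congr _ fun a' => expect_congr _ fun b =>
      expect_congr _ fun c => expect_comm _ _ _).trans (expect_comm₃ _ _ _ _ _))

variable {a₂ a₂'} in
lemma expect_transDist_recv₂₃ (h : a₂ ≠ a₂')
    (F : Q → U₁ × X₁ → U₂ × X₂ → X₃ → Y₁ × Y₂ × Y₃ → U₂ × X₂ → X₃ → ℝ) :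
    (expect (κ.transDist W a₁ f₁ a₂ f₂ a₃) fun z => F z.1.1 (entry z.1.2.1 a₁ f₁)
      (entry z.1.2.2.1 a₂ f₂) (z.1.2.2.2 (a₁, a₂, a₃)) z.2 (entry z.1.2.2.1 a₂' f₂)
      (z.1.2.2.2 (a₁, a₂', a₃'))) =
      κ.E W fun q a b c y => expect (compProd (κ.u₂ q) (κ.x₂ q)) fun b' =>
        expect (κ.x₃ q a.1 b'.1) fun c' => F q a b c y b' c' := by
  rw [expect_transDist]
  have h' : (a₁, a₂, a₃) ≠ (a₁, a₂', a₃') := fun e => h (Prod.ext_iff.1 (Prod.ext_iff.1 e).2).1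
  exact expect_congr _ fun q => ((expect_congr _ fun r₁ => (expect_congr _ fun r₂ =>
    expect_piDist_apply₂ _ h' fun c c' =>
      expect (W (entry r₁ a₁ f₁).2 (entry r₂ a₂ f₂).2 c) fun y =>
        F q (entry r₁ a₁ f₁) (entry r₂ a₂ f₂) c y (entry r₂ a₂' f₂) c').trans
    (expect_rows_entry₂ _ _ h f₂ fun b b' => expect (κ.x₃ q (entry r₁ a₁ f₁).1 b.1) fun c =>
      expect (κ.x₃ q (entry r₁ a₁ f₁).1 b'.1) fun c' =>
      expect (W (entry r₁ a₁ f₁).2 b.2 c) fun y =>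
        F q (entry r₁ a₁ f₁) b c y b' c')).trans
    (expect_rows_entry _ _ a₁ f₁ fun a => expect (compProd (κ.u₂ q) (κ.x₂ q)) fun b =>
      expect (compProd (κ.u₂ q) (κ.x₂ q)) fun b' =>
      expect (κ.x₃ q a.1 b.1) fun c => expect (κ.x₃ q a.1 b'.1) fun c' =>
      expect (W a.2 b.2 c) fun y => F q a b c y b' c')).trans
    (expect_congr _ fun a => expect_congr _ fun b => (expect_congr _ fun b' =>
      expect_congr _ fun c => expect_comm _ _ _).trans (expect_comm₂ _ _ _ _))

variable {a₁ a₁' a₂ a₂'} in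
lemma expect_transDist_recv₁₂₃ (h₁ : a₁ ≠ a₁') (h₂ : a₂ ≠ a₂')
    (F : Q → U₁ × X₁ → U₂ × X₂ → X₃ → Y₁ × Y₂ × Y₃ → U₁ × X₁ → U₂ × X₂ → X₃ → ℝ) :
    (expect (κ.transDist W a₁ f₁ a₂ f₂ a₃) fun z => F z.1.1 (entry z.1.2.1 a₁ f₁)
      (entry z.1.2.2.1 a₂ f₂) (z.1.2.2.2 (a₁, a₂, a₃)) z.2 (entry z.1.2.1 a₁' f₁)
      (entry z.1.2.2.1 a₂' f₂) (z.1.2.2.2 (a₁', a₂', a₃'))) =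
      κ.E W fun q a b c y => expect (compProd (κ.u₁ q) (κ.x₁ q)) fun a' =>
        expect (compProd (κ.u₂ q) (κ.x₂ q)) fun b' =>
        expect (κ.x₃ q a'.1 b'.1) fun c' => F q a b c y a' b' c' := by
  rw [expect_transDist]
  have h' : (a₁, a₂, a₃) ≠ (a₁', a₂', a₃') := fun e => h₁ (Prod.ext_iff.1 e).1
  exact expect_congr _ fun q => ((expect_congr _ fun r₁ => (expect_congr _ fun r₂ =>
    expect_piDist_apply₂ _ h' fun c c' =>
      expect (W (entry r₁ a₁ f₁).2 (entry r₂ a₂ f₂).2 c) fun y =>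
        F q (entry r₁ a₁ f₁) (entry r₂ a₂ f₂) c y (entry r₁ a₁' f₁) (entry r₂ a₂' f₂) c').trans
    (expect_rows_entry₂ _ _ h₂ f₂ fun b b' => expect (κ.x₃ q (entry r₁ a₁ f₁).1 b.1) fun c =>
      expect (κ.x₃ q (entry r₁ a₁' f₁).1 b'.1) fun c' =>
      expect (W (entry r₁ a₁ f₁).2 b.2 c) fun y =>
        F q (entry r₁ a₁ f₁) b c y (entry r₁ a₁' f₁) b' c')).trans
    (expect_rows_entry₂ _ _ h₁ f₁ fun a a' => expect (compProd (κ.u₂ q) (κ.x₂ q)) fun b =>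
      expect (compProd (κ.u₂ q) (κ.x₂ q)) fun b' =>
      expect (κ.x₃ q a.1 b.1) fun c => expect (κ.x₃ q a'.1 b'.1) fun c' =>
      expect (W a.2 b.2 c) fun y => F q a b c y a' b' c')).trans
    (expect_congr _ fun a => (expect_congr _ fun a' => expect_congr _ fun b =>
      (expect_congr _ fun b' => expect_congr _ fun c => expect_comm _ _ _).trans
      (expect_comm₂ _ _ _ _)).trans (expect_comm₃ _ _ _ _ _))

end Kernels

end Codebook

/-! ### Tail bounds and thresholds of the tests. -/

section Probability
variable {α Ω A B C ι : Type*} [Fintype α] [Fintype Ω] [Fintype A] [Fintype B] [Fintype C]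

open Classical in
/-- The probability of the event `P`. -/
def prob (d : Dist α) (P : α → Prop) : ℝ := expect d fun a => if P a then 1 else 0

lemma prob_mono (d : Dist α) {P P' : α → Prop} (h : ∀ a, P a → P' a) : prob d P ≤ prob d P' :=
  expect_mono d fun a => by
    by_cases h1 : P a
    · simp [h1, h a h1]
    · simp only [h1, if_false]
      split_ifs <;> simp

lemma prob_or_le (d : Dist α) (P P' : α → Prop) :
    prob d (fun a => P a ∨ P' a) ≤ prob d P + prob d P' := by
  rw [prob, prob, prob, ← expect_add]
  refine expect_mono d fun a => ?_
  by_cases h1 : P a <;> by_cases h2 : P' a <;> simp [h1, h2]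

lemma prob_exists_le (d : Dist α) (s : Finset ι) (P : ι → α → Prop) :
    prob d (fun a => ∃ i ∈ s, P i a) ≤ ∑ i ∈ s, prob d (P i) := by
  classical
  induction s using Finset.induction_on with
  | empty => simp [prob]
  | insert i s hi ih =>
    rw [Finset.sum_insert hi]
    refine le_trans (le_trans (prob_mono d ?_) (prob_or_le d (P i) fun a => ∃ i ∈ s, P i a))
      (by linarith)
    intro a
    simp

lemma prob_exists_le_card (d : Dist α) (s : Finset ι) (P : ι → α → Prop) {c : ℝ}
    (h : ∀ i ∈ s, prob d (P i) ≤ c) : prob d (fun a => ∃ i ∈ s, P i a) ≤ s.card * c := by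
  refine (prob_exists_le d s P).trans ((Finset.sum_le_sum h).trans ?_)
  simp

/-- A product of nonnegative variables of mean at most `1` rarely exceeds `2 ^ (m γ)`. -/
lemma prob_lt_prod_le (d : Dist α) (r : α → ℝ) (hr : ∀ a, 0 ≤ r a) (h : expect d r ≤ 1) (m : ℕ)
    (γ : ℝ) :
    prob (piDist fun _ : Fin m => d) (fun z => (2 : ℝ) ^ (m * γ) < ∏ k, r (z k)) ≤
      2 ^ (-(m * γ)) := by
  have h2 : (0 : ℝ) < 2 ^ (m * γ) := by positivity
  have h1 : prob (piDist fun _ : Fin m => d) (fun z => (2 : ℝ) ^ (m * γ) < ∏ k, r (z k)) ≤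
      expect (piDist fun _ : Fin m => d) fun z => 2 ^ (-(m * γ)) * ∏ k, r (z k) := by
    refine expect_mono _ fun z => ?_
    rw [Real.rpow_neg two_pos.le]
    split_ifs with hz
    · rw [inv_mul_eq_div, one_le_div h2]
      exact hz.le
    · exact mul_nonneg (inv_nonneg.2 h2.le) (Finset.prod_nonneg fun k _ => hr _)
  rw [expect_mul_left, expect_piDist_prod (fun _ : Fin m => d) fun _ => r] at h1
  refine h1.trans (mul_le_of_le_one_right (by positivity) ?_)
  exact Finset.prod_le_one (fun _ _ => expect_nonneg d hr) fun _ _ => h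

/-- Chernoff's bound: the indicator is at most the product of the exponential factors, whose mean
factorizes. Only points of positive mass are compared, since the logarithms need `r > 0`. -/
lemma prob_not_lt_prod_le (d : Dist α) (r : α → ℝ) (hr : ∀ a, 0 < d.1 a → 0 < r a) (m : ℕ)
    {s : ℝ} (hs : 0 < s) (γ : ℝ) :
    prob (piDist fun _ : Fin m => d) (fun z => ¬(2 : ℝ) ^ (m * γ) < ∏ k, r (z k)) ≤
      (expect d fun a => (2 : ℝ) ^ (s * (γ - Real.logb 2 (r a)))) ^ m := by
  have h1 : prob (piDist fun _ : Fin m => d) (fun z => ¬(2 : ℝ) ^ (m * γ) < ∏ k, r (z k)) ≤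
      expect (piDist fun _ : Fin m => d) fun z =>
        ∏ k, (2 : ℝ) ^ (s * (γ - Real.logb 2 (r (z k)))) := by
    refine expect_mono_of_pos _ fun z hz => ?_
    have hz' : ∀ k, 0 < r (z k) := fun k => by
      refine hr _ ((d.2.1 _).lt_of_ne fun h0 => ?_)
      have : (piDist fun _ : Fin m => d).1 z = 0 :=
        Finset.prod_eq_zero (Finset.mem_univ k) h0.symm
      exact hz.ne' this
    split_ifs with hlt
    · replace hlt := not_lt.1 hlt
      rw [← Real.rpow_sum_of_pos two_pos, ← Finset.mul_sum, Finset.sum_sub_distrib]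
      refine Real.one_le_rpow one_le_two (mul_nonneg hs.le ?_)
      have h2 := Real.logb_le_logb_of_le one_lt_two (Finset.prod_pos fun k _ => hz' k) hlt
      rw [Real.logb_prod (hf := fun k _ => (hz' k).ne'), Real.logb_rpow two_pos (by norm_num)] at h2
      simpa using h2
    · positivity
  rw [expect_piDist_prod (fun _ : Fin m => d)
    fun _ a => (2 : ℝ) ^ (s * (γ - Real.logb 2 (r a)))] at h1
  simpa using h1

/-- The density of jointly distributed letters rarely falls below a threshold. -/
lemma prob_not_lt_density_le (d : Dist Ω) (D : Dist α) (π : α → Ω)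
    (hπ : ∀ f : Ω → ℝ, expect D (fun z => f (π z)) = expect d f) (X : Ω → A) (Y : Ω → B)
    (Z : Ω → C) (m : ℕ) {s : ℝ} (hs : 0 < s) (γ : ℝ) :
    prob (piDist fun _ : Fin m => D) (fun z => ¬(2 : ℝ) ^ (m * γ) <
      ∏ k, density d.1 X Y Z (X (π (z k))) (Y (π (z k))) (Z (π (z k)))) ≤
      (expect d fun ω => (2 : ℝ) ^
        (s * (γ - Real.logb 2 (density d.1 X Y Z (X ω) (Y ω) (Z ω))))) ^ m := by
  classical
  rw [← hπ]
  refine prob_not_lt_prod_le D (fun z => density d.1 X Y Z (X (π z)) (Y (π z)) (Z (π z)))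
    (fun z hz => density_pos d X Y Z ?_) m hs γ
  -- To see that `π z` has positive mass under `d`, `hπ` is tested on the indicator of the point `π
  -- z`.
  have h1 := hπ fun ω => if ω = π z then 1 else 0
  have h2 : expect d (fun ω => if ω = π z then 1 else 0) = d.1 (π z) := by simp [expect]
  rw [← h2, ← h1]
  refine hz.trans_le (le_trans (by simp) (Finset.single_le_sum
    (f := fun z' => D.1 z' * if π z' = π z then 1 else 0) (fun z' _ => ?_) (Finset.mem_univ z)))
  have := D.2.1 z'
  split_ifs <;> simp [this]

/-- The threshold `γ` lets a test with error exponent `δ` accept the correct sub-messages and reject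
`2 ^ (m r)` wrong ones; in the case `¬act` there are no wrong ones. -/
structure Threshold (d : Dist Ω) (X : Ω → A) (Y : Ω → B) (Z : Ω → C) (r : ℝ) (act : Prop)
    (γ δ : ℝ) : Prop where
  nonneg : 0 ≤ δ
  lt_one : δ < 1
  moment : ∃ s, 0 < s ∧ (expect d fun ω => (2 : ℝ) ^
        (s * (γ - Real.logb 2 (density d.1 X Y Z (X ω) (Y ω) (Z ω))))) ≤ δ
  rate : act → (2 : ℝ) ^ (r - γ) ≤ δ

lemma exists_threshold (d : Dist Ω) (X : Ω → A) (Y : Ω → B) (Z : Ω → C) {r : ℝ} {act : Prop}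
    (h : act → r < condMI d.1 X Y Z) : ∃ γ δ, Threshold d X Y Z r act γ δ := by
  rw [condMI_eq_expect] at h
  obtain ⟨γ, hγ, hr⟩ : ∃ γ, γ < (expect d fun ω =>
      Real.logb 2 (density d.1 X Y Z (X ω) (Y ω) (Z ω))) ∧ (act → r < γ) := by
    by_cases ha : act
    · obtain ⟨γ, h1, h2⟩ := exists_between (h ha)
      exact ⟨γ, h2, fun _ => h1⟩
    -- Without wrong candidates only acceptance of the true one matters, so any `γ` below the mutual
    -- information will do.
    · exact ⟨_, sub_one_lt _, fun h => absurd h ha⟩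
  obtain ⟨s, hs, hlt⟩ := exists_expect_rpow_lt_one d _ hγ
  by_cases ha : act
  · refine ⟨γ, max _ ((2 : ℝ) ^ (r - γ)), le_max_of_le_right (by positivity), max_lt hlt ?_,
      ⟨s, hs, le_max_left _ _⟩, fun _ => le_max_right _ _⟩
    exact Real.rpow_lt_one_of_one_lt_of_neg one_lt_two (by linarith [hr ha])
  · exact ⟨γ, _, expect_nonneg d fun ω => by positivity, hlt, ⟨s, hs, le_rfl⟩,
      fun h => absurd h ha⟩

namespace Threshold
variable {d : Dist Ω} {X : Ω → A} {Y : Ω → B} {Z : Ω → C} {r : ℝ} {act : Prop} {γ δ : ℝ}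

lemma correct (h : Threshold d X Y Z r act γ δ) (D : Dist α) (π : α → Ω)
    (hπ : ∀ f : Ω → ℝ, expect D (fun z => f (π z)) = expect d f) (m : ℕ) :
    prob (piDist fun _ : Fin m => D) (fun z => ¬(2 : ℝ) ^ (m * γ) <
      ∏ k, density d.1 X Y Z (X (π (z k))) (Y (π (z k))) (Z (π (z k)))) ≤ δ ^ m := by
  obtain ⟨s, hs, hle⟩ := h.moment
  exact (prob_not_lt_density_le d D π hπ X Y Z m hs γ).trans
    (pow_le_pow_left₀ (expect_nonneg d fun ω => by positivity) hle m)

/-- This is the union bound over `N` wrong candidates. The constant `c` leaves room for rounding the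
numbers of sub-messages. -/
lemma count (h : Threshold d X Y Z r act γ δ) {m : ℕ} {c N : ℝ} (hc : 0 ≤ c)
    (hN : N ≤ c * 2 ^ (m * r)) (hact : ¬act → N = 0) : N * 2 ^ (-(m * γ)) ≤ c * δ ^ m := by
  by_cases ha : act
  · calc N * 2 ^ (-(m * γ)) ≤ (c * 2 ^ (m * r)) * 2 ^ (-(m * γ)) :=
          mul_le_mul_of_nonneg_right hN (by positivity)
      _ = c * (2 ^ (r - γ)) ^ m := by
          rw [mul_assoc, ← Real.rpow_add two_pos, ← Real.rpow_mul_natCast two_pos.le]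
          ring_nf
      _ ≤ c * δ ^ m := mul_le_mul_of_nonneg_left
          (pow_le_pow_left₀ (by positivity) (h.rate ha) m) hc
  · rw [hact ha, zero_mul]
    exact mul_nonneg hc (pow_nonneg h.nonneg m)

end Threshold

end Probability

/-! ### Error probabilities of the relay and of a receiver in a random codebook. -/

section Tests
variable {Q U₁ U₂ X₁ X₂ X₃ Y₁ Y₂ Y₃ A₁ A₂ A₃ B : Type*} [Fintype Q] [Fintype U₁] [Fintype U₂]
  [Fintype X₁] [Fintype X₂] [Fintype X₃] [Fintype Y₁] [Fintype Y₂] [Fintype Y₃] [Fintype B]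
  [Fintype A₁] [Fintype A₂] [Fintype A₃] [DecidableEq A₁] [DecidableEq A₂] [DecidableEq A₃]

section Densities
variable (p : Letters Q U₁ U₂ X₁ X₂ X₃ Y₁ Y₂ Y₃ → ℝ) (Y : Letters Q U₁ U₂ X₁ X₂ X₃ Y₁ Y₂ Y₃ → B)
  (L : LetterBook Q U₁ U₂ X₁ X₂ X₃ A₁ A₂ A₃) (a₁ f₁ : A₁) (a₂ f₂ : A₂) (a₃ : A₃) (y : B)

/-- The density for `I(X₁; Y | U₁, X₂, X₃, Q)`. -/
def relayDensity₁ : ℝ :=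
  density p (fun ω => ω.x₁) Y (fun ω => (ω.u₁, ω.x₂, ω.x₃, ω.q)) (entry L.2.1 a₁ f₁).2 y
    ((entry L.2.1 a₁ f₁).1, (entry L.2.2.1 a₂ f₂).2, L.2.2.2 (a₁, a₂, a₃), L.1)

/-- The density for `I(X₂; Y | U₂, X₁, X₃, Q)`. -/
def relayDensity₂ : ℝ :=
  density p (fun ω => ω.x₂) Y (fun ω => (ω.u₂, ω.x₁, ω.x₃, ω.q)) (entry L.2.2.1 a₂ f₂).2 y
    ((entry L.2.2.1 a₂ f₂).1, (entry L.2.1 a₁ f₁).2, L.2.2.2 (a₁, a₂, a₃), L.1)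

/-- The density for `I(X₁, X₂; Y | U₁, U₂, X₃, Q)`. -/
def relayDensity₁₂ : ℝ :=
  density p (fun ω => (ω.x₁, ω.x₂)) Y (fun ω => (ω.u₁, ω.u₂, ω.x₃, ω.q))
    ((entry L.2.1 a₁ f₁).2, (entry L.2.2.1 a₂ f₂).2) y
    ((entry L.2.1 a₁ f₁).1, (entry L.2.2.1 a₂ f₂).1, L.2.2.2 (a₁, a₂, a₃), L.1)

/-- The density for `I(X₃; Y | X₁, X₂, U₁, U₂, Q)`. -/
def recvDensity₃ : ℝ :=
  density p (fun ω => ω.x₃) Y (fun ω => (ω.x₁, ω.x₂, ω.u₁, ω.u₂, ω.q)) (L.2.2.2 (a₁, a₂, a₃)) y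
    ((entry L.2.1 a₁ f₁).2, (entry L.2.2.1 a₂ f₂).2, (entry L.2.1 a₁ f₁).1,
      (entry L.2.2.1 a₂ f₂).1, L.1)

/-- The density for `I(X₁, X₃; Y | X₂, U₂, Q)`. -/
def recvDensity₁₃ : ℝ :=
  density p (fun ω => (ω.x₁, ω.x₃)) Y (fun ω => (ω.x₂, ω.u₂, ω.q))
    ((entry L.2.1 a₁ f₁).2, L.2.2.2 (a₁, a₂, a₃)) y
    ((entry L.2.2.1 a₂ f₂).2, (entry L.2.2.1 a₂ f₂).1, L.1)

/-- The density for `I(X₂, X₃; Y | X₁, U₁, Q)`. -/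
def recvDensity₂₃ : ℝ :=
  density p (fun ω => (ω.x₂, ω.x₃)) Y (fun ω => (ω.x₁, ω.u₁, ω.q))
    ((entry L.2.2.1 a₂ f₂).2, L.2.2.2 (a₁, a₂, a₃)) y
    ((entry L.2.1 a₁ f₁).2, (entry L.2.1 a₁ f₁).1, L.1)

/-- The density for `I(X₁, X₂, X₃; Y | Q)`. -/
def recvDensity₁₂₃ : ℝ :=
  density p (fun ω => (ω.x₁, ω.x₂, ω.x₃)) Y (fun ω => ω.q)
    ((entry L.2.1 a₁ f₁).2, (entry L.2.2.1 a₂ f₂).2, L.2.2.2 (a₁, a₂, a₃)) y L.1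

end Densities

section Passing
variable (p : Letters Q U₁ U₂ X₁ X₂ X₃ Y₁ Y₂ Y₃ → ℝ) (Y : Letters Q U₁ U₂ X₁ X₂ X₃ Y₁ Y₂ Y₃ → B)
  {m : ℕ} (L : Fin m → LetterBook Q U₁ U₂ X₁ X₂ X₃ A₁ A₂ A₃) (y : Fin m → B)

/-- The sub-messages pass the tests of the relay. -/
def RelayPass (γ₁ γ₂ γ₁₂ : ℝ) (a₁ : A₁) (a₂ : A₂) (a₃ : A₃) (f : A₁ × A₂) : Prop :=
  (2 : ℝ) ^ (m * γ₁) < ∏ k, relayDensity₁ p Y (L k) a₁ f.1 a₂ f.2 a₃ (y k) ∧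
  (2 : ℝ) ^ (m * γ₂) < ∏ k, relayDensity₂ p Y (L k) a₁ f.1 a₂ f.2 a₃ (y k) ∧
  (2 : ℝ) ^ (m * γ₁₂) < ∏ k, relayDensity₁₂ p Y (L k) a₁ f.1 a₂ f.2 a₃ (y k)

/-- The sub-messages pass the tests of a receiver. -/
def RecvPass (γ₃ γ₁₃ γ₂₃ γ₁₂₃ : ℝ) (f₁ : A₁) (f₂ : A₂) (a : (A₁ × A₂) × A₃) : Prop :=
  (2 : ℝ) ^ (m * γ₃) < ∏ k, recvDensity₃ p Y (L k) a.1.1 f₁ a.1.2 f₂ a.2 (y k) ∧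
  (2 : ℝ) ^ (m * γ₁₃) < ∏ k, recvDensity₁₃ p Y (L k) a.1.1 f₁ a.1.2 f₂ a.2 (y k) ∧
  (2 : ℝ) ^ (m * γ₂₃) < ∏ k, recvDensity₂₃ p Y (L k) a.1.1 f₁ a.1.2 f₂ a.2 (y k) ∧
  (2 : ℝ) ^ (m * γ₁₂₃) < ∏ k, recvDensity₁₂₃ p Y (L k) a.1.1 f₁ a.1.2 f₂ a.2 (y k)

end Passing

namespace Kernels.Generates
variable {κ : Kernels Q U₁ U₂ X₁ X₂ X₃} {W : Channel X₁ X₂ X₃ Y₁ Y₂ Y₃}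
  {d : Dist (Letters Q U₁ U₂ X₁ X₂ X₃ Y₁ Y₂ Y₃)}

/-- All letters that belong to given sub-messages. -/
def toLetters (a₁ f₁ : A₁) (a₂ f₂ : A₂) (a₃ : A₃)
    (z : LetterBook Q U₁ U₂ X₁ X₂ X₃ A₁ A₂ A₃ × (Y₁ × Y₂ × Y₃)) :
    Letters Q U₁ U₂ X₁ X₂ X₃ Y₁ Y₂ Y₃ :=
  ⟨z.1.1, (entry z.1.2.1 a₁ f₁).1, (entry z.1.2.2.1 a₂ f₂).1, (entry z.1.2.1 a₁ f₁).2,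
    (entry z.1.2.2.1 a₂ f₂).2, z.1.2.2.2 (a₁, a₂, a₃), z.2.1, z.2.2.1, z.2.2.2⟩

lemma expect_toLetters (h : κ.Generates W d) (a₁ f₁ : A₁) (a₂ f₂ : A₂) (a₃ : A₃)
    (g : Letters Q U₁ U₂ X₁ X₂ X₃ Y₁ Y₂ Y₃ → ℝ) :
    expect (κ.transDist W a₁ f₁ a₂ f₂ a₃) (fun z => g (toLetters a₁ f₁ a₂ f₂ a₃ z)) =
      expect d g := by
  rw [h g]
  exact κ.expect_transDist_correct W a₁ f₁ a₂ f₂ a₃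
    fun q a b c y => g ⟨q, a.1, b.1, a.2, b.2, c, y.1, y.2.1, y.2.2⟩

/-- The error probability of the relay in a random codebook. -/
lemma prob_relay_le (h : κ.Generates W d) (φ : Y₁ × Y₂ × Y₃ → B)
    {Y : Letters Q U₁ U₂ X₁ X₂ X₃ Y₁ Y₂ Y₃ → B} (hY : Y = fun ω => φ (ω.y₁, ω.y₂, ω.y₃))
    {r₁ r₂ r₁₂ γ₁ δ₁ γ₂ δ₂ γ₁₂ δ₁₂ : ℝ} {act₁ act₂ act₁₂ : Prop}
    (t₁ : Threshold d (fun ω => ω.x₁) Y (fun ω => (ω.u₁, ω.x₂, ω.x₃, ω.q)) r₁ act₁ γ₁ δ₁)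
    (t₂ : Threshold d (fun ω => ω.x₂) Y (fun ω => (ω.u₂, ω.x₁, ω.x₃, ω.q)) r₂ act₂ γ₂ δ₂)
    (t₁₂ : Threshold d (fun ω => (ω.x₁, ω.x₂)) Y (fun ω => (ω.u₁, ω.u₂, ω.x₃, ω.q)) r₁₂ act₁₂
      γ₁₂ δ₁₂) (m : ℕ) (a₁ f₁ : A₁) (a₂ f₂ : A₂) (a₃ : A₃) :
    prob (piDist fun _ : Fin m => κ.transDist W a₁ f₁ a₂ f₂ a₃) (fun z =>
      ¬RelayPass d.1 Y (fun k => (z k).1) (fun k => φ (z k).2) γ₁ γ₂ γ₁₂ a₁ a₂ a₃ (f₁, f₂) ∨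
      ∃ f, f ≠ (f₁, f₂) ∧
        RelayPass d.1 Y (fun k => (z k).1) (fun k => φ (z k).2) γ₁ γ₂ γ₁₂ a₁ a₂ a₃ f) ≤
      δ₁ ^ m + δ₂ ^ m + δ₁₂ ^ m + ((Fintype.card A₁ - 1 : ℕ) : ℝ) * 2 ^ (-(m * γ₁)) +
      ((Fintype.card A₂ - 1 : ℕ) : ℝ) * 2 ^ (-(m * γ₂)) +
      (((Fintype.card A₁ - 1) * (Fintype.card A₂ - 1) : ℕ) : ℝ) * 2 ^ (-(m * γ₁₂)) := by
  subst hY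
  set Y : Letters Q U₁ U₂ X₁ X₂ X₃ Y₁ Y₂ Y₃ → B := fun ω => φ (ω.y₁, ω.y₂, ω.y₃)
  set D := κ.transDist W a₁ f₁ a₂ f₂ a₃
  have c₁ := t₁.correct D (toLetters a₁ f₁ a₂ f₂ a₃) (h.expect_toLetters a₁ f₁ a₂ f₂ a₃) m
  have c₂ := t₂.correct D (toLetters a₁ f₁ a₂ f₂ a₃) (h.expect_toLetters a₁ f₁ a₂ f₂ a₃) m
  have c₁₂ := t₁₂.correct D (toLetters a₁ f₁ a₂ f₂ a₃) (h.expect_toLetters a₁ f₁ a₂ f₂ a₃) m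
  have w₁ := prob_exists_le_card (piDist fun _ : Fin m => D) (Finset.univ.erase f₁)
    (fun f z => (2 : ℝ) ^ (m * γ₁) <
      ∏ k, relayDensity₁ d.1 Y (z k).1 a₁ f a₂ f₂ a₃ (φ (z k).2)) (fun f hf =>
    prob_lt_prod_le D (fun z => relayDensity₁ d.1 Y z.1 a₁ f a₂ f₂ a₃ (φ z.2))
      (fun _ => density_nonneg _ _ _ _ _ _ _)
      ((κ.expect_transDist_relay₁ W a₁ a₂ a₃ (Finset.ne_of_mem_erase hf).symm
        fun q a b c y t => density d.1 (fun ω => ω.x₁) Y (fun ω => (ω.u₁, ω.x₂, ω.x₃, ω.q))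
          t (φ y) (a.1, b.2, c, q)).trans_le (h.relay₁ φ)) m γ₁)
  have w₂ := prob_exists_le_card (piDist fun _ : Fin m => D) (Finset.univ.erase f₂)
    (fun f z => (2 : ℝ) ^ (m * γ₂) <
      ∏ k, relayDensity₂ d.1 Y (z k).1 a₁ f₁ a₂ f a₃ (φ (z k).2)) (fun f hf =>
    prob_lt_prod_le D (fun z => relayDensity₂ d.1 Y z.1 a₁ f₁ a₂ f a₃ (φ z.2))
      (fun _ => density_nonneg _ _ _ _ _ _ _)
      ((κ.expect_transDist_relay₂ W a₁ a₂ a₃ (Finset.ne_of_mem_erase hf).symm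
        fun q a b c y t => density d.1 (fun ω => ω.x₂) Y (fun ω => (ω.u₂, ω.x₁, ω.x₃, ω.q))
          t (φ y) (b.1, a.2, c, q)).trans_le (h.relay₂ φ)) m γ₂)
  have w₁₂ := prob_exists_le_card (piDist fun _ : Fin m => D)
    (Finset.univ.erase f₁ ×ˢ Finset.univ.erase f₂)
    (fun f z => (2 : ℝ) ^ (m * γ₁₂) <
      ∏ k, relayDensity₁₂ d.1 Y (z k).1 a₁ f.1 a₂ f.2 a₃ (φ (z k).2)) (fun f hf =>
    prob_lt_prod_le D (fun z => relayDensity₁₂ d.1 Y z.1 a₁ f.1 a₂ f.2 a₃ (φ z.2))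
      (fun _ => density_nonneg _ _ _ _ _ _ _)
      ((κ.expect_transDist_relay₁₂ W a₁ a₂ a₃
        (Finset.ne_of_mem_erase (Finset.mem_product.1 hf).1).symm
        (Finset.ne_of_mem_erase (Finset.mem_product.1 hf).2).symm
        fun q a b c y t s => density d.1 (fun ω => (ω.x₁, ω.x₂)) Y
          (fun ω => (ω.u₁, ω.u₂, ω.x₃, ω.q)) (t, s) (φ y) (a.1, b.1, c, q)).trans_le
        (h.relay₁₂ φ)) m γ₁₂)
  simp only [Finset.card_product, Finset.card_erase_of_mem (Finset.mem_univ _),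
    Finset.card_univ] at w₁ w₂ w₁₂
  refine le_trans (prob_mono _ ?_) ((prob_or_le _ _ _).trans (add_le_add ((prob_or_le _ _ _).trans
    (add_le_add ((prob_or_le _ _ _).trans (add_le_add ((prob_or_le _ _ _).trans (add_le_add
      ((prob_or_le _ _ _).trans (add_le_add c₁ c₂)) c₁₂)) w₁)) w₂)) w₁₂))
  -- A wrong accepted pair is charged to a single test, chosen by which of its components are wrong.
  rintro z (hz | ⟨⟨g₁, g₂⟩, hne, g1, g2, g3⟩)
  · have : ¬(_ ∧ _ ∧ _) := hz
    rw [not_and_or, not_and_or] at this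
    rcases this with h1 | h1 | h1
    · exact Or.inl (Or.inl (Or.inl (Or.inl (Or.inl h1))))
    · exact Or.inl (Or.inl (Or.inl (Or.inl (Or.inr h1))))
    · exact Or.inl (Or.inl (Or.inl (Or.inr h1)))
  · by_cases e₁ : g₁ = f₁
    · subst e₁
      exact Or.inl (Or.inr ⟨g₂, by simpa using hne, g2⟩)
    · by_cases e₂ : g₂ = f₂
      · subst e₂
        exact Or.inl (Or.inl (Or.inr ⟨g₁, by simpa using e₁, g1⟩))
      · exact Or.inr ⟨(g₁, g₂), by simp [e₁, e₂], g3⟩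

/-- The error probability of a receiver in a random codebook. -/
lemma prob_recv_le (h : κ.Generates W d) (φ : Y₁ × Y₂ × Y₃ → B)
    {Y : Letters Q U₁ U₂ X₁ X₂ X₃ Y₁ Y₂ Y₃ → B} (hY : Y = fun ω => φ (ω.y₁, ω.y₂, ω.y₃))
    {r₃ r₁₃ r₂₃ r₁₂₃ γ₃ δ₃ γ₁₃ δ₁₃ γ₂₃ δ₂₃ γ₁₂₃ δ₁₂₃ : ℝ} {act₃ act₁₃ act₂₃ act₁₂₃ : Prop}
    (t₃ : Threshold d (fun ω => ω.x₃) Y (fun ω => (ω.x₁, ω.x₂, ω.u₁, ω.u₂, ω.q)) r₃ act₃ γ₃ δ₃)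
    (t₁₃ : Threshold d (fun ω => (ω.x₁, ω.x₃)) Y (fun ω => (ω.x₂, ω.u₂, ω.q)) r₁₃ act₁₃ γ₁₃ δ₁₃)
    (t₂₃ : Threshold d (fun ω => (ω.x₂, ω.x₃)) Y (fun ω => (ω.x₁, ω.u₁, ω.q)) r₂₃ act₂₃ γ₂₃ δ₂₃)
    (t₁₂₃ : Threshold d (fun ω => (ω.x₁, ω.x₂, ω.x₃)) Y (fun ω => ω.q) r₁₂₃ act₁₂₃ γ₁₂₃ δ₁₂₃)
    (m : ℕ) (a₁ f₁ : A₁) (a₂ f₂ : A₂) (a₃ : A₃) :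
    prob (piDist fun _ : Fin m => κ.transDist W a₁ f₁ a₂ f₂ a₃) (fun z =>
      ¬RecvPass d.1 Y (fun k => (z k).1) (fun k => φ (z k).2) γ₃ γ₁₃ γ₂₃ γ₁₂₃ f₁ f₂
        ((a₁, a₂), a₃) ∨
      ∃ a, a ≠ ((a₁, a₂), a₃) ∧
        RecvPass d.1 Y (fun k => (z k).1) (fun k => φ (z k).2) γ₃ γ₁₃ γ₂₃ γ₁₂₃ f₁ f₂ a) ≤
      δ₃ ^ m + δ₁₃ ^ m + δ₂₃ ^ m + δ₁₂₃ ^ m +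
      ((Fintype.card A₃ - 1 : ℕ) : ℝ) * 2 ^ (-(m * γ₃)) +
      (((Fintype.card A₁ - 1) * Fintype.card A₃ : ℕ) : ℝ) * 2 ^ (-(m * γ₁₃)) +
      (((Fintype.card A₂ - 1) * Fintype.card A₃ : ℕ) : ℝ) * 2 ^ (-(m * γ₂₃)) +
      (((Fintype.card A₁ - 1) * ((Fintype.card A₂ - 1) * Fintype.card A₃) : ℕ) : ℝ) *
        2 ^ (-(m * γ₁₂₃)) := by
  subst hY
  set Y : Letters Q U₁ U₂ X₁ X₂ X₃ Y₁ Y₂ Y₃ → B := fun ω => φ (ω.y₁, ω.y₂, ω.y₃)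
  set D := κ.transDist W a₁ f₁ a₂ f₂ a₃
  have c₃ := t₃.correct D (toLetters a₁ f₁ a₂ f₂ a₃) (h.expect_toLetters a₁ f₁ a₂ f₂ a₃) m
  have c₁₃ := t₁₃.correct D (toLetters a₁ f₁ a₂ f₂ a₃) (h.expect_toLetters a₁ f₁ a₂ f₂ a₃) m
  have c₂₃ := t₂₃.correct D (toLetters a₁ f₁ a₂ f₂ a₃) (h.expect_toLetters a₁ f₁ a₂ f₂ a₃) m
  have c₁₂₃ := t₁₂₃.correct D (toLetters a₁ f₁ a₂ f₂ a₃) (h.expect_toLetters a₁ f₁ a₂ f₂ a₃) m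
  have w₃ := prob_exists_le_card (piDist fun _ : Fin m => D) (Finset.univ.erase a₃)
    (fun a z => (2 : ℝ) ^ (m * γ₃) <
      ∏ k, recvDensity₃ d.1 Y (z k).1 a₁ f₁ a₂ f₂ a (φ (z k).2)) (fun a ha =>
    prob_lt_prod_le D (fun z => recvDensity₃ d.1 Y z.1 a₁ f₁ a₂ f₂ a (φ z.2))
      (fun _ => density_nonneg _ _ _ _ _ _ _)
      ((κ.expect_transDist_recv₃ W a₁ f₁ a₂ f₂ (Finset.ne_of_mem_erase ha).symm
        fun q a b _ y t => density d.1 (fun ω => ω.x₃) Y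
          (fun ω => (ω.x₁, ω.x₂, ω.u₁, ω.u₂, ω.q)) t (φ y)
          (a.2, b.2, a.1, b.1, q)).trans_le (h.recv₃ φ)) m γ₃)
  -- The relay sub-message runs over all values, the correct one included, so the count is `(K₁ - 1)
  -- K₃`.
  have w₁₃ := prob_exists_le_card (piDist fun _ : Fin m => D)
    (Finset.univ.erase a₁ ×ˢ (Finset.univ : Finset A₃))
    (fun a z => (2 : ℝ) ^ (m * γ₁₃) <
      ∏ k, recvDensity₁₃ d.1 Y (z k).1 a.1 f₁ a₂ f₂ a.2 (φ (z k).2)) (fun a ha =>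
    prob_lt_prod_le D (fun z => recvDensity₁₃ d.1 Y z.1 a.1 f₁ a₂ f₂ a.2 (φ z.2))
      (fun _ => density_nonneg _ _ _ _ _ _ _)
      ((κ.expect_transDist_recv₁₃ W f₁ a₂ f₂ a₃ a.2
        (Finset.ne_of_mem_erase (Finset.mem_product.1 ha).1).symm
        fun q _ b _ y a' c' => density d.1 (fun ω => (ω.x₁, ω.x₃)) Y
          (fun ω => (ω.x₂, ω.u₂, ω.q)) (a'.2, c') (φ y) (b.2, b.1, q)).trans_le
        (h.recv₁₃ φ)) m γ₁₃)
  have w₂₃ := prob_exists_le_card (piDist fun _ : Fin m => D)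
    (Finset.univ.erase a₂ ×ˢ (Finset.univ : Finset A₃))
    (fun a z => (2 : ℝ) ^ (m * γ₂₃) <
      ∏ k, recvDensity₂₃ d.1 Y (z k).1 a₁ f₁ a.1 f₂ a.2 (φ (z k).2)) (fun a ha =>
    prob_lt_prod_le D (fun z => recvDensity₂₃ d.1 Y z.1 a₁ f₁ a.1 f₂ a.2 (φ z.2))
      (fun _ => density_nonneg _ _ _ _ _ _ _)
      ((κ.expect_transDist_recv₂₃ W a₁ f₁ f₂ a₃ a.2
        (Finset.ne_of_mem_erase (Finset.mem_product.1 ha).1).symm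
        fun q a _ _ y b' c' => density d.1 (fun ω => (ω.x₂, ω.x₃)) Y
          (fun ω => (ω.x₁, ω.u₁, ω.q)) (b'.2, c') (φ y) (a.2, a.1, q)).trans_le
        (h.recv₂₃ φ)) m γ₂₃)
  have w₁₂₃ := prob_exists_le_card (piDist fun _ : Fin m => D)
    (Finset.univ.erase a₁ ×ˢ Finset.univ.erase a₂ ×ˢ (Finset.univ : Finset A₃))
    (fun a z => (2 : ℝ) ^ (m * γ₁₂₃) <
      ∏ k, recvDensity₁₂₃ d.1 Y (z k).1 a.1 f₁ a.2.1 f₂ a.2.2 (φ (z k).2)) (fun a ha =>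
    prob_lt_prod_le D (fun z => recvDensity₁₂₃ d.1 Y z.1 a.1 f₁ a.2.1 f₂ a.2.2 (φ z.2))
      (fun _ => density_nonneg _ _ _ _ _ _ _)
      ((κ.expect_transDist_recv₁₂₃ W f₁ f₂ a₃ a.2.2
        (Finset.ne_of_mem_erase (Finset.mem_product.1 ha).1).symm
        (Finset.ne_of_mem_erase (Finset.mem_product.1 (Finset.mem_product.1 ha).2).1).symm
        fun q _ _ _ y a' b' c' => density d.1 (fun ω => (ω.x₁, ω.x₂, ω.x₃)) Y
          (fun ω => ω.q) (a'.2, b'.2, c') (φ y) q).trans_le (h.recv₁₂₃ φ)) m γ₁₂₃)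
  simp only [Finset.card_product, Finset.card_erase_of_mem (Finset.mem_univ _),
    Finset.card_univ] at w₃ w₁₃ w₂₃ w₁₂₃
  refine le_trans (prob_mono _ ?_) ((prob_or_le _ _ _).trans (add_le_add ((prob_or_le _ _ _).trans
    (add_le_add ((prob_or_le _ _ _).trans (add_le_add ((prob_or_le _ _ _).trans (add_le_add
      ((prob_or_le _ _ _).trans (add_le_add ((prob_or_le _ _ _).trans (add_le_add
      ((prob_or_le _ _ _).trans (add_le_add c₃ c₁₃)) c₂₃)) c₁₂₃)) w₃)) w₁₃)) w₂₃)) w₁₂₃))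
  -- Correctness of `b₃` matters only if `b₁` and `b₂` are both correct. In the other cases the
  -- relay letter is renewed anyway.
  rintro z (hz | ⟨⟨⟨b₁, b₂⟩, b₃⟩, hne, g3, g13, g23, g123⟩)
  · have : ¬(_ ∧ _ ∧ _ ∧ _) := hz
    rw [not_and_or, not_and_or, not_and_or] at this
    refine Or.inl (Or.inl (Or.inl (Or.inl ?_)))
    rcases this with h1 | h1 | h1 | h1
    · exact Or.inl (Or.inl (Or.inl h1))
    · exact Or.inl (Or.inl (Or.inr h1))
    · exact Or.inl (Or.inr h1)
    · exact Or.inr h1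
  · by_cases e₁ : b₁ = a₁
    · subst e₁
      by_cases e₂ : b₂ = a₂
      · subst e₂
        exact Or.inl (Or.inl (Or.inl (Or.inr ⟨b₃, by simpa using hne, g3⟩)))
      · exact Or.inl (Or.inr ⟨(b₂, b₃), by simp [e₂], g23⟩)
    · by_cases e₂ : b₂ = a₂
      · subst e₂
        exact Or.inl (Or.inl (Or.inr ⟨(b₁, b₃), by simp [e₁], g13⟩))
      · exact Or.inr ⟨(b₁, b₂, b₃), by simp [e₁, e₂], g123⟩

end Kernels.Generates

end Tests

/-! ### Sub-message counts and random coding in one block. -/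

/-- The number `K` of sub-messages for blocks of length `m` is at most `c 2 ^ (m ρ R)`, and there is
only one sub-message in the case of rate zero. -/
structure SizeBound (c ρ R : ℝ) (m K : ℕ) : Prop where
  pos : 0 < K
  le : (K : ℝ) ≤ c * 2 ^ (m * (ρ * R))
  eq_one : R = 0 → K = 1

namespace SizeBound
variable {c ρ R R' R'' : ℝ} {m K K' K'' : ℕ}

lemma sub_one_le (h : SizeBound c ρ R m K) : ((K - 1 : ℕ) : ℝ) ≤ c * 2 ^ (m * (ρ * R)) :=
  le_trans (by exact_mod_cast Nat.sub_le K 1) h.le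

lemma sub_one_eq (h : SizeBound c ρ R m K) (hR : ¬R ≠ 0) : K - 1 = 0 := by
  rw [h.eq_one (not_not.1 hR)]

lemma mul_le {r r' b b' : ℝ} {N N' : ℕ} (h : (N : ℝ) ≤ b * 2 ^ (m * (ρ * r)))
    (h' : (N' : ℝ) ≤ b' * 2 ^ (m * (ρ * r'))) :
    ((N * N' : ℕ) : ℝ) ≤ b * b' * 2 ^ (m * (ρ * (r + r'))) := by
  push_cast
  calc (N : ℝ) * N' ≤ (b * 2 ^ (m * (ρ * r))) * (b' * 2 ^ (m * (ρ * r'))) :=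
        mul_le_mul h h' (by positivity) (le_trans (by positivity) h)
    _ = b * b' * 2 ^ (m * (ρ * (r + r'))) := by
        rw [mul_add, mul_add, Real.rpow_add two_pos]
        ring

end SizeBound

section OneBlock
variable {Q U₁ U₂ X₁ X₂ X₃ Y₁ Y₂ Y₃ B : Type*} [Fintype Q] [Fintype U₁] [Fintype U₂]
  [Fintype X₁] [Fintype X₂] [Fintype X₃] [Fintype Y₁] [Fintype Y₂] [Fintype Y₃] [Fintype B]
  {κ : Kernels Q U₁ U₂ X₁ X₂ X₃} {W : Channel X₁ X₂ X₃ Y₁ Y₂ Y₃}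
  {d : Dist (Letters Q U₁ U₂ X₁ X₂ X₃ Y₁ Y₂ Y₃)}

lemma mul_lt_of_le_of_pos {ρ R I : ℝ} (hρ : ρ < 1) (hR : 0 < R) (h : R ≤ I) : ρ * R < I := by
  nlinarith

/-- Any accepted candidate may be chosen, because the error event already allows for every wrong
acceptance. The default output is harmless: it is used only when the true candidate is rejected too.
-/
lemma exists_decoder {Y A : Type*} [Nonempty A] (pass : Y → A → Prop) :
    ∃ dec : Y → A, ∀ y a, dec y ≠ a → ¬pass y a ∨ ∃ a', a' ≠ a ∧ pass y a' := by
  classical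
  refine ⟨fun y => if h : ∃ a, pass y a then h.choose else Classical.arbitrary A, fun y a h => ?_⟩
  by_cases hy : ∃ a, pass y a
  · simp only [dif_pos hy] at h
    exact Or.inr ⟨_, h, hy.choose_spec⟩
  · exact Or.inl fun ha => hy ⟨a, ha⟩

namespace Kernels.Generates

/-- Thresholds and `ε` are fixed before the block length and the sub-message counts. For the joint
test it is enough to treat `R₁ ≠ 0`: a candidate wrong in both components needs a second sub-message
of source `1`, and `R₁ > 0` makes `ρ * (R₁ + R₂)` strictly admissible. -/
lemma exists_relay_thresholds (h : κ.Generates W d) (φ : Y₁ × Y₂ × Y₃ → B)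
    {Y : Letters Q U₁ U₂ X₁ X₂ X₃ Y₁ Y₂ Y₃ → B} (hY : Y = fun ω => φ (ω.y₁, ω.y₂, ω.y₃))
    {R₁ R₂ R₃ c ρ : ℝ} (hR₁ : 0 ≤ R₁) (hR₂ : 0 ≤ R₂) (hc : 0 ≤ c) (hρ : ρ < 1)
    (h₁ : R₁ ≤ condMI d.1 (fun ω => ω.x₁) Y (fun ω => (ω.u₁, ω.x₂, ω.x₃, ω.q)))
    (h₂ : R₂ ≤ condMI d.1 (fun ω => ω.x₂) Y (fun ω => (ω.u₂, ω.x₁, ω.x₃, ω.q)))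
    (h₁₂ : R₁ + R₂ ≤ condMI d.1 (fun ω => (ω.x₁, ω.x₂)) Y (fun ω => (ω.u₁, ω.u₂, ω.x₃, ω.q))) :
    ∃ (γ₁ γ₂ γ₁₂ : ℝ) (ε : ℕ → ℝ), Tendsto ε atTop (𝓝 0) ∧ ∀ {m K₁ K₂ K₃ : ℕ},
      SizeBound c ρ R₁ m K₁ → SizeBound c ρ R₂ m K₂ → SizeBound c ρ R₃ m K₃ →
      ∀ (a₁ f₁ : Fin K₁) (a₂ f₂ : Fin K₂) (a₃ : Fin K₃),
      prob (piDist fun _ : Fin m => κ.transDist W a₁ f₁ a₂ f₂ a₃) (fun z =>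
        ¬RelayPass d.1 Y (fun k => (z k).1) (fun k => φ (z k).2) γ₁ γ₂ γ₁₂ a₁ a₂ a₃ (f₁, f₂) ∨
        ∃ f, f ≠ (f₁, f₂) ∧
          RelayPass d.1 Y (fun k => (z k).1) (fun k => φ (z k).2) γ₁ γ₂ γ₁₂ a₁ a₂ a₃ f) ≤ ε m := by
  obtain ⟨γ₁, δ₁, t₁⟩ := exists_threshold d (fun ω => ω.x₁) Y (fun ω => (ω.u₁, ω.x₂, ω.x₃, ω.q))
    (r := ρ * R₁) (act := R₁ ≠ 0) fun hne => mul_lt_of_le_of_pos hρ (hR₁.lt_of_ne' hne) h₁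
  obtain ⟨γ₂, δ₂, t₂⟩ := exists_threshold d (fun ω => ω.x₂) Y (fun ω => (ω.u₂, ω.x₁, ω.x₃, ω.q))
    (r := ρ * R₂) (act := R₂ ≠ 0) fun hne => mul_lt_of_le_of_pos hρ (hR₂.lt_of_ne' hne) h₂
  obtain ⟨γ₁₂, δ₁₂, t₁₂⟩ := exists_threshold d (fun ω => (ω.x₁, ω.x₂)) Y
    (fun ω => (ω.u₁, ω.u₂, ω.x₃, ω.q)) (r := ρ * (R₁ + R₂)) (act := R₁ ≠ 0) fun hne =>
      mul_lt_of_le_of_pos hρ (add_pos_of_pos_of_nonneg (hR₁.lt_of_ne' hne) hR₂) h₁₂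
  refine ⟨γ₁, γ₂, γ₁₂, fun m => δ₁ ^ m + δ₂ ^ m + δ₁₂ ^ m + c * δ₁ ^ m + c * δ₂ ^ m +
    c * c * δ₁₂ ^ m, ?_, fun {m K₁ K₂ K₃} s₁ s₂ s₃ a₁ f₁ a₂ f₂ a₃ => ?_⟩
  · have e₁ := tendsto_pow_atTop_nhds_zero_of_lt_one t₁.nonneg t₁.lt_one
    have e₂ := tendsto_pow_atTop_nhds_zero_of_lt_one t₂.nonneg t₂.lt_one
    have e₁₂ := tendsto_pow_atTop_nhds_zero_of_lt_one t₁₂.nonneg t₁₂.lt_one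
    simpa using ((((e₁.add e₂).add e₁₂).add (e₁.const_mul c)).add (e₂.const_mul c)).add
      (e₁₂.const_mul (c * c))
  · refine (h.prob_relay_le φ hY t₁ t₂ t₁₂ m a₁ f₁ a₂ f₂ a₃).trans ?_
    simp only [Fintype.card_fin]
    refine add_le_add (add_le_add (add_le_add le_rfl ?_) ?_) ?_
    · exact t₁.count hc s₁.sub_one_le fun hne => by rw [s₁.sub_one_eq hne, Nat.cast_zero]
    · exact t₂.count hc s₂.sub_one_le fun hne => by rw [s₂.sub_one_eq hne, Nat.cast_zero]
    · exact t₁₂.count (mul_nonneg hc hc) (SizeBound.mul_le s₁.sub_one_le s₂.sub_one_le)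
        fun hne => by rw [s₁.sub_one_eq hne, zero_mul, Nat.cast_zero]

lemma exists_recv_thresholds (h : κ.Generates W d) (φ : Y₁ × Y₂ × Y₃ → B)
    {Y : Letters Q U₁ U₂ X₁ X₂ X₃ Y₁ Y₂ Y₃ → B} (hY : Y = fun ω => φ (ω.y₁, ω.y₂, ω.y₃))
    {R₁ R₂ R₃ c ρ : ℝ} (hR₁ : 0 ≤ R₁) (hR₂ : 0 ≤ R₂) (hR₃ : 0 ≤ R₃) (hc : 0 ≤ c) (hρ : ρ < 1)
    (h₃ : R₃ ≤ condMI d.1 (fun ω => ω.x₃) Y (fun ω => (ω.x₁, ω.x₂, ω.u₁, ω.u₂, ω.q)))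
    (h₁₃ : R₁ + R₃ ≤ condMI d.1 (fun ω => (ω.x₁, ω.x₃)) Y (fun ω => (ω.x₂, ω.u₂, ω.q)))
    (h₂₃ : R₂ + R₃ ≤ condMI d.1 (fun ω => (ω.x₂, ω.x₃)) Y (fun ω => (ω.x₁, ω.u₁, ω.q)))
    (h₁₂₃ : R₁ + R₂ + R₃ ≤ condMI d.1 (fun ω => (ω.x₁, ω.x₂, ω.x₃)) Y (fun ω => ω.q)) :
    ∃ (γ₃ γ₁₃ γ₂₃ γ₁₂₃ : ℝ) (ε : ℕ → ℝ), Tendsto ε atTop (𝓝 0) ∧ ∀ {m K₁ K₂ K₃ : ℕ},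
      SizeBound c ρ R₁ m K₁ → SizeBound c ρ R₂ m K₂ → SizeBound c ρ R₃ m K₃ →
      ∀ (a₁ f₁ : Fin K₁) (a₂ f₂ : Fin K₂) (a₃ : Fin K₃),
      prob (piDist fun _ : Fin m => κ.transDist W a₁ f₁ a₂ f₂ a₃) (fun z =>
        ¬RecvPass d.1 Y (fun k => (z k).1) (fun k => φ (z k).2) γ₃ γ₁₃ γ₂₃ γ₁₂₃ f₁ f₂
          ((a₁, a₂), a₃) ∨
        ∃ a, a ≠ ((a₁, a₂), a₃) ∧
          RecvPass d.1 Y (fun k => (z k).1) (fun k => φ (z k).2) γ₃ γ₁₃ γ₂₃ γ₁₂₃ f₁ f₂ a) ≤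
        ε m := by
  obtain ⟨γ₃, δ₃, t₃⟩ := exists_threshold d (fun ω => ω.x₃) Y
    (fun ω => (ω.x₁, ω.x₂, ω.u₁, ω.u₂, ω.q)) (r := ρ * R₃) (act := R₃ ≠ 0) fun hne =>
      mul_lt_of_le_of_pos hρ (hR₃.lt_of_ne' hne) h₃
  obtain ⟨γ₁₃, δ₁₃, t₁₃⟩ := exists_threshold d (fun ω => (ω.x₁, ω.x₃)) Y
    (fun ω => (ω.x₂, ω.u₂, ω.q)) (r := ρ * (R₁ + R₃)) (act := R₁ ≠ 0) fun hne =>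
      mul_lt_of_le_of_pos hρ (add_pos_of_pos_of_nonneg (hR₁.lt_of_ne' hne) hR₃) h₁₃
  obtain ⟨γ₂₃, δ₂₃, t₂₃⟩ := exists_threshold d (fun ω => (ω.x₂, ω.x₃)) Y
    (fun ω => (ω.x₁, ω.u₁, ω.q)) (r := ρ * (R₂ + R₃)) (act := R₂ ≠ 0) fun hne =>
      mul_lt_of_le_of_pos hρ (add_pos_of_pos_of_nonneg (hR₂.lt_of_ne' hne) hR₃) h₂₃
  -- The sum is bracketed like the count `(K₁ - 1) * ((K₂ - 1) * K₃)` to which it is matched.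
  obtain ⟨γ₁₂₃, δ₁₂₃, t₁₂₃⟩ := exists_threshold d (fun ω => (ω.x₁, ω.x₂, ω.x₃)) Y
    (fun ω => ω.q) (r := ρ * (R₁ + (R₂ + R₃))) (act := R₁ ≠ 0) fun hne =>
      mul_lt_of_le_of_pos hρ (add_pos_of_pos_of_nonneg (hR₁.lt_of_ne' hne) (add_nonneg hR₂ hR₃))
        (by rwa [← add_assoc])
  refine ⟨γ₃, γ₁₃, γ₂₃, γ₁₂₃, fun m => δ₃ ^ m + δ₁₃ ^ m + δ₂₃ ^ m + δ₁₂₃ ^ m + c * δ₃ ^ m +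
    c * c * δ₁₃ ^ m + c * c * δ₂₃ ^ m + c * (c * c) * δ₁₂₃ ^ m, ?_,
    fun {m K₁ K₂ K₃} s₁ s₂ s₃ a₁ f₁ a₂ f₂ a₃ => ?_⟩
  · have e₃ := tendsto_pow_atTop_nhds_zero_of_lt_one t₃.nonneg t₃.lt_one
    have e₁₃ := tendsto_pow_atTop_nhds_zero_of_lt_one t₁₃.nonneg t₁₃.lt_one
    have e₂₃ := tendsto_pow_atTop_nhds_zero_of_lt_one t₂₃.nonneg t₂₃.lt_one
    have e₁₂₃ := tendsto_pow_atTop_nhds_zero_of_lt_one t₁₂₃.nonneg t₁₂₃.lt_one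
    simpa using ((((((e₃.add e₁₃).add e₂₃).add e₁₂₃).add (e₃.const_mul c)).add
      (e₁₃.const_mul (c * c))).add (e₂₃.const_mul (c * c))).add (e₁₂₃.const_mul (c * (c * c)))
  · refine (h.prob_recv_le φ hY t₃ t₁₃ t₂₃ t₁₂₃ m a₁ f₁ a₂ f₂ a₃).trans ?_
    simp only [Fintype.card_fin]
    refine add_le_add (add_le_add (add_le_add (add_le_add le_rfl ?_) ?_) ?_) ?_
    · exact t₃.count hc s₃.sub_one_le fun hne => by rw [s₃.sub_one_eq hne, Nat.cast_zero]
    · exact t₁₃.count (mul_nonneg hc hc) (SizeBound.mul_le s₁.sub_one_le s₃.le)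
        fun hne => by rw [s₁.sub_one_eq hne, zero_mul, Nat.cast_zero]
    · exact t₂₃.count (mul_nonneg hc hc) (SizeBound.mul_le s₂.sub_one_le s₃.le)
        fun hne => by rw [s₂.sub_one_eq hne, zero_mul, Nat.cast_zero]
    · exact t₁₂₃.count (mul_nonneg hc (mul_nonneg hc hc))
        (SizeBound.mul_le s₁.sub_one_le (SizeBound.mul_le s₂.sub_one_le s₃.le))
        fun hne => by rw [s₁.sub_one_eq hne, zero_mul, Nat.cast_zero]

end Kernels.Generates

/-- The codewords and the decoders of a decode-and-forward scheme in one block. -/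
structure BlockCode (X₁ X₂ X₃ Y₁ Y₂ Y₃ : Type*) (K₁ K₂ K₃ m : ℕ) where
  enc₁ : Fin K₁ → Fin K₁ → Fin m → X₁
  enc₂ : Fin K₂ → Fin K₂ → Fin m → X₂
  enc₃ : Fin K₁ × Fin K₂ → Fin K₃ → Fin m → X₃
  relayDec : Fin K₁ × Fin K₂ → Fin K₃ → (Fin m → Y₃) → Fin K₁ × Fin K₂
  recvDec₁ : Fin K₁ × Fin K₂ → (Fin m → Y₁) → (Fin K₁ × Fin K₂) × Fin K₃
  recvDec₂ : Fin K₁ × Fin K₂ → (Fin m → Y₂) → (Fin K₁ × Fin K₂) × Fin K₃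

namespace BlockCode
variable {K₁ K₂ K₃ m : ℕ} (b : BlockCode X₁ X₂ X₃ Y₁ Y₂ Y₃ K₁ K₂ K₃ m)
  (W : Channel X₁ X₂ X₃ Y₁ Y₂ Y₃) (a f : Fin K₁ × Fin K₂) (a₃ : Fin K₃)

/-- The distribution of the outputs in a block. -/
def outDist : Dist (Fin m → Y₁ × Y₂ × Y₃) :=
  piDist fun k => W (b.enc₁ a.1 f.1 k) (b.enc₂ a.2 f.2 k) (b.enc₃ a a₃ k)

/-- The relay or a receiver errs, although it knows the sub-messages that it relies on. -/
def Fails (y : Fin m → Y₁ × Y₂ × Y₃) : Prop :=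
  b.relayDec a a₃ (fun k => (y k).2.2) ≠ f ∨ b.recvDec₁ f (fun k => (y k).1) ≠ (a, a₃) ∨
    b.recvDec₂ f (fun k => (y k).2.1) ≠ (a, a₃)

end BlockCode

/-- For large block lengths there are block codes whose error probability, averaged over an
arbitrary family of sub-messages, is small. -/
lemma exists_blockCode (h : κ.Generates W d) {R₁ R₂ R₃ c ρ : ℝ} (hR₁ : 0 ≤ R₁) (hR₂ : 0 ≤ R₂)
    (hR₃ : 0 ≤ R₃) (hc : 0 ≤ c) (hρ : ρ < 1)
    (h₁ : R₁ ≤ condMI d.1 (fun ω => ω.x₁) (fun ω => ω.y₃) (fun ω => (ω.u₁, ω.x₂, ω.x₃, ω.q)))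
    (h₂ : R₂ ≤ condMI d.1 (fun ω => ω.x₂) (fun ω => ω.y₃) (fun ω => (ω.u₂, ω.x₁, ω.x₃, ω.q)))
    (h₁₂ : R₁ + R₂ ≤ condMI d.1 (fun ω => (ω.x₁, ω.x₂)) (fun ω => ω.y₃)
      (fun ω => (ω.u₁, ω.u₂, ω.x₃, ω.q)))
    (h₃ : R₃ ≤ min
      (condMI d.1 (fun ω => ω.x₃) (fun ω => ω.y₁) (fun ω => (ω.x₁, ω.x₂, ω.u₁, ω.u₂, ω.q)))
      (condMI d.1 (fun ω => ω.x₃) (fun ω => ω.y₂) (fun ω => (ω.x₁, ω.x₂, ω.u₁, ω.u₂, ω.q))))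
    (h₁₃ : R₁ + R₃ ≤ min
      (condMI d.1 (fun ω => (ω.x₁, ω.x₃)) (fun ω => ω.y₁) (fun ω => (ω.x₂, ω.u₂, ω.q)))
      (condMI d.1 (fun ω => (ω.x₁, ω.x₃)) (fun ω => ω.y₂) (fun ω => (ω.x₂, ω.u₂, ω.q))))
    (h₂₃ : R₂ + R₃ ≤ min
      (condMI d.1 (fun ω => (ω.x₂, ω.x₃)) (fun ω => ω.y₁) (fun ω => (ω.x₁, ω.u₁, ω.q)))
      (condMI d.1 (fun ω => (ω.x₂, ω.x₃)) (fun ω => ω.y₂) (fun ω => (ω.x₁, ω.u₁, ω.q))))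
    (h₁₂₃ : R₁ + R₂ + R₃ ≤ min
      (condMI d.1 (fun ω => (ω.x₁, ω.x₂, ω.x₃)) (fun ω => ω.y₁) (fun ω => ω.q))
      (condMI d.1 (fun ω => (ω.x₁, ω.x₂, ω.x₃)) (fun ω => ω.y₂) (fun ω => ω.q))) :
    ∃ ε : ℕ → ℝ, Tendsto ε atTop (𝓝 0) ∧ ∀ {m K₁ K₂ K₃ : ℕ},
      SizeBound c ρ R₁ m K₁ → SizeBound c ρ R₂ m K₂ → SizeBound c ρ R₃ m K₃ →
      ∀ (ι : Type) [Fintype ι] (a f : ι → Fin K₁ × Fin K₂) (a₃ : ι → Fin K₃),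
      ∃ b : BlockCode X₁ X₂ X₃ Y₁ Y₂ Y₃ K₁ K₂ K₃ m,
        ∑ i, prob (b.outDist W (a i) (f i) (a₃ i)) (b.Fails (a i) (f i) (a₃ i)) ≤
          Fintype.card ι * ε m := by
  simp only [le_min_iff] at h₃ h₁₃ h₂₃ h₁₂₃
  obtain ⟨γ₁, γ₂, γ₁₂, ε₀, hε₀, H₀⟩ := h.exists_relay_thresholds (R₃ := R₃) (fun y => y.2.2)
    (Y := fun ω => ω.y₃) rfl hR₁ hR₂ hc hρ h₁ h₂ h₁₂
  obtain ⟨α₃, α₁₃, α₂₃, α₁₂₃, ε₁, hε₁, H₁⟩ := h.exists_recv_thresholds (fun y => y.1)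
    (Y := fun ω => ω.y₁) rfl hR₁ hR₂ hR₃ hc hρ h₃.1 h₁₃.1 h₂₃.1 h₁₂₃.1
  obtain ⟨β₃, β₁₃, β₂₃, β₁₂₃, ε₂, hε₂, H₂⟩ := h.exists_recv_thresholds (fun y => y.2.1)
    (Y := fun ω => ω.y₂) rfl hR₁ hR₂ hR₃ hc hρ h₃.2 h₁₃.2 h₂₃.2 h₁₂₃.2
  refine ⟨fun m => ε₀ m + (ε₁ m + ε₂ m), by simpa using hε₀.add (hε₁.add hε₂), ?_⟩
  intro m K₁ K₂ K₃ s₁ s₂ s₃ ι _ a f a₃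
  have : NeZero K₁ := ⟨s₁.pos.ne'⟩
  have : NeZero K₂ := ⟨s₂.pos.ne'⟩
  have : NeZero K₃ := ⟨s₃.pos.ne'⟩
  choose dec₀ hdec₀ using fun (L : Fin m → LetterBook Q U₁ U₂ X₁ X₂ X₃ (Fin K₁) (Fin K₂) (Fin K₃))
    (a : Fin K₁ × Fin K₂) (a₃ : Fin K₃) => exists_decoder fun (y : Fin m → Y₃) =>
      RelayPass d.1 (fun ω => ω.y₃) L y γ₁ γ₂ γ₁₂ a.1 a.2 a₃
  choose dec₁ hdec₁ using fun (L : Fin m → LetterBook Q U₁ U₂ X₁ X₂ X₃ (Fin K₁) (Fin K₂) (Fin K₃))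
    (f : Fin K₁ × Fin K₂) => exists_decoder fun (y : Fin m → Y₁) =>
      RecvPass d.1 (fun ω => ω.y₁) L y α₃ α₁₃ α₂₃ α₁₂₃ f.1 f.2
  choose dec₂ hdec₂ using fun (L : Fin m → LetterBook Q U₁ U₂ X₁ X₂ X₃ (Fin K₁) (Fin K₂) (Fin K₃))
    (f : Fin K₁ × Fin K₂) => exists_decoder fun (y : Fin m → Y₂) =>
      RecvPass d.1 (fun ω => ω.y₂) L y β₃ β₁₃ β₂₃ β₁₂₃ f.1 f.2
  let code : (Fin m → LetterBook Q U₁ U₂ X₁ X₂ X₃ (Fin K₁) (Fin K₂) (Fin K₃)) →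
      BlockCode X₁ X₂ X₃ Y₁ Y₂ Y₃ K₁ K₂ K₃ m := fun L =>
    { enc₁ := fun a f k => ((L k).2.1 a).2 f
      enc₂ := fun a f k => ((L k).2.2.1 a).2 f
      enc₃ := fun a a₃ k => (L k).2.2.2 (a.1, a.2, a₃)
      relayDec := dec₀ L
      recvDec₁ := dec₁ L
      recvDec₂ := dec₂ L }
  -- For fixed sub-messages, averaging over the codebook turns a failure into the error events of
  -- the three decoders.
  have key : ∀ (a f : Fin K₁ × Fin K₂) (a₃ : Fin K₃),
      (expect (piDist fun _ : Fin m => κ.bookDist (Fin K₁) (Fin K₂) (Fin K₃)) fun L =>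
        prob ((code L).outDist W a f a₃) ((code L).Fails a f a₃)) ≤ ε₀ m + (ε₁ m + ε₂ m) := by
    intro a f a₃
    classical
    refine (expect_piDist_compProd (fun _ : Fin m => κ.bookDist (Fin K₁) (Fin K₂) (Fin K₃))
      (fun _ => Kernels.outDist W a.1 f.1 a.2 f.2 a₃)
      (fun L y => if (code L).Fails a f a₃ y then 1 else 0)).trans_le ?_
    refine (prob_mono (piDist fun _ : Fin m => κ.transDist W a.1 f.1 a.2 f.2 a₃) ?_).trans
      ((prob_or_le _ _ _).trans (add_le_add (H₀ s₁ s₂ s₃ a.1 f.1 a.2 f.2 a₃) ((prob_or_le _ _ _).trans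
        (add_le_add (H₁ s₁ s₂ s₃ a.1 f.1 a.2 f.2 a₃) (H₂ s₁ s₂ s₃ a.1 f.1 a.2 f.2 a₃)))))
    rintro z (hz | hz | hz)
    · exact Or.inl (hdec₀ _ _ _ _ _ hz)
    · exact Or.inr (Or.inl (hdec₁ _ _ _ _ hz))
    · exact Or.inr (Or.inr (hdec₂ _ _ _ _ hz))
  -- By linearity one codebook meets the bound for the whole sum. No independence between members of
  -- the family is involved, so the same codebook can serve every block.
  obtain ⟨L, hL⟩ := exists_le_of_expect_le
    (piDist fun _ : Fin m => κ.bookDist (Fin K₁) (Fin K₂) (Fin K₃))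
    (f := fun L => ∑ i, prob ((code L).outDist W (a i) (f i) (a₃ i))
      ((code L).Fails (a i) (f i) (a₃ i))) (c := Fintype.card ι * (ε₀ m + (ε₁ m + ε₂ m))) (by
    rw [expect_sum]
    refine (Finset.sum_le_sum fun i _ => key (a i) (f i) (a₃ i)).trans ?_
    rw [Finset.sum_const, Finset.card_univ, nsmul_eq_mul])
  exact ⟨code L, hL⟩

end OneBlock

/-! ### Total mass of a channel with causal feedback. -/

section Causal

/-- The outputs of a channel whose input depends causally on the past outputs have total
probability `1`. -/
lemma sum_prod_causal {Y : Type*} [Fintype Y] {n : ℕ} (k : (j : Fin n) → (Fin j → Y) → Dist Y) :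
    ∑ y : Fin n → Y, ∏ j, (k j (past y j)).1 (y j) = 1 := by
  induction n with
  | zero => simp
  | succ n ih =>
    -- The last output is summed out first: its law depends on the earlier outputs, and no other
    -- factor involves it.
    rw [← (Fin.snocEquiv fun _ : Fin (n + 1) => Y).sum_comp, Fintype.sum_prod_type_right]
    have h1 : ∀ (y : Fin n → Y) (a : Y),
        ∏ j, (k j (past (Fin.snocEquiv (fun _ : Fin (n + 1) => Y) (a, y)) j)).1
          (Fin.snocEquiv (fun _ : Fin (n + 1) => Y) (a, y) j) =
        (∏ j : Fin n, (k j.castSucc (past y j)).1 (y j)) * (k (Fin.last n) y).1 a := by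
      intro y a
      rw [Fin.prod_univ_castSucc]
      congr 1
      · refine Finset.prod_congr rfl fun j _ => ?_
        have h2 : past (Fin.snocEquiv (fun _ : Fin (n + 1) => Y) (a, y)) j.castSucc = past y j := by
          funext i
          exact Fin.snoc_castSucc (α := fun _ => Y) a y ⟨i, i.isLt.trans j.isLt⟩
        rw [h2]
        simp
      · have h2 : past (Fin.snocEquiv (fun _ : Fin (n + 1) => Y) (a, y)) (Fin.last n) = y := by
          funext i
          exact Fin.snoc_castSucc (α := fun _ => Y) a y ⟨i, i.isLt⟩
        rw [h2]
        simp
    simp only [h1, ← Finset.mul_sum, (k _ _).2.2, mul_one]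
    exact ih fun j => k j.castSucc

end Causal

/-! ### Splitting messages into sub-messages. -/

section Splitting

lemma exists_injective_of_le_pow {M K B : ℕ} (h : M ≤ K ^ B) :
    ∃ e : Fin M → Fin B → Fin K, Function.Injective e := by
  have : Fintype.card (Fin M) ≤ Fintype.card (Fin B → Fin K) := by simpa using h
  obtain ⟨e⟩ := Function.Embedding.nonempty_of_card_le this
  exact ⟨e, e.injective⟩

/-- The `B` free coordinates are flanked by the two fixed ones, which gives `B + 2` sub-messages for
`B + 1` blocks. -/
lemma exists_split {M K B : ℕ} (hM : 0 < M) (dummy : Fin K) (h : M ≤ K ^ B) :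
    ∃ (split : Fin M → Fin (B + 1 + 1) → Fin K) (merge : (Fin (B + 1 + 1) → Fin K) → Fin M),
      (∀ w, split w 0 = dummy) ∧ (∀ w, split w (Fin.last (B + 1)) = dummy) ∧
        ∀ w, merge (split w) = w := by
  obtain ⟨e, he⟩ := exists_injective_of_le_pow h
  have : Nonempty (Fin M) := ⟨⟨0, hM⟩⟩
  let split : Fin M → Fin (B + 1 + 1) → Fin K := fun w =>
    Fin.snoc (α := fun _ => Fin K) (Fin.cons (α := fun _ => Fin K) dummy (e w)) dummy
  have hs : Function.Injective split := by
    intro w w' hw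
    refine he (funext fun i => ?_)
    have h1 := congrFun hw i.succ.castSucc
    simpa only [split, Fin.snoc_castSucc, Fin.cons_succ] using h1
  refine ⟨split, Function.invFun split, fun w => ?_, fun w => ?_, Function.leftInverse_invFun hs⟩
  · change Fin.snoc (α := fun _ => Fin K) _ _ (Fin.castSucc 0) = dummy
    rw [Fin.snoc_castSucc, Fin.cons_zero]
  · exact Fin.snoc_last (α := fun _ => Fin K) _ _

end Splitting

/-! ### From block codes to a scheme: causality, induction over blocks, the genie. -/

namespace DFScheme

variable {X₁ X₂ X₃ Y₁ Y₂ Y₃ : Type*} {M₁ M₂ M₃ n : ℕ}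
  (S : DFScheme X₁ X₂ X₃ Y₁ Y₂ Y₃ M₁ M₂ M₃ n)

lemma time_injective (b : Fin S.B) : Function.Injective (S.time b) := by
  intro k k' h
  have h1 := finProdFinEquiv.injective (Fin.castLE_injective S.fits h)
  exact (Prod.ext_iff.1 h1).2

lemma time_val (b : Fin S.B) (k : Fin S.m) : (S.time b k : ℕ) = k + S.m * b := by
  simp [time]

lemma time_lt (b : Fin S.B) (k : Fin S.m) : (S.time b k : ℕ) < S.B * S.m := by
  simpa only [time, Fin.val_castLE] using (finProdFinEquiv (b, k)).isLt

lemma exists_time_of_lt {j : Fin n} (h : (j : ℕ) < S.B * S.m) : ∃ b k, S.time b k = j := by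
  refine ⟨(finProdFinEquiv.symm ⟨j, h⟩).1, (finProdFinEquiv.symm ⟨j, h⟩).2, Fin.ext ?_⟩
  have h1 : (finProdFinEquiv (finProdFinEquiv.symm ⟨(j : ℕ), h⟩)).val = j := by
    rw [Equiv.apply_symm_apply]
  exact h1

/-- The sequence that consists of the blocks `f b` and of the symbol `fill` after the last block. -/
def atTime {X : Type*} (f : Fin S.B → Fin S.m → X) (fill : X) (j : Fin n) : X :=
  if h : (j : ℕ) < S.B * S.m then
    f (finProdFinEquiv.symm ⟨j, h⟩).1 (finProdFinEquiv.symm ⟨j, h⟩).2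
  else fill

lemma atTime_time {X : Type*} (f : Fin S.B → Fin S.m → X) (fill : X) (b : Fin S.B) (k : Fin S.m) :
    S.atTime f fill (S.time b k) = f b k := by
  have h1 : finProdFinEquiv.symm ⟨(S.time b k : ℕ), S.time_lt b k⟩ = (b, k) := by
    rw [Equiv.symm_apply_eq]
    rfl
  rw [atTime, dif_pos (S.time_lt b k), h1]

lemma atTime_of_le {X : Type*} (f : Fin S.B → Fin S.m → X) (fill : X) {j : Fin n}
    (h : S.B * S.m ≤ j) : S.atTime f fill j = fill :=
  dif_neg (not_lt.2 h)

lemma relayEst_zero (w₃ : Fin M₃) (y₃ : Fin n → Y₃) :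
    S.relayEst w₃ y₃ 0 = (S.dummy₁, S.dummy₂) := rfl

lemma relayEst_succ (w₃ : Fin M₃) (y₃ : Fin n → Y₃) (b : Fin S.B) :
    S.relayEst w₃ y₃ b.succ =
      S.relayDec b (S.relayEst w₃ y₃ b.castSucc) (S.split₃ w₃ b) (S.block y₃ b) := by
  rw [relayEst, Fin.induction_succ]
  rfl

/-- Causality of the relay: its estimate with index `b` uses only the first `b` blocks, that is, the
first `m b` outputs. -/
lemma relayEst_congr (w₃ : Fin M₃) {y y' : Fin n → Y₃} (b : Fin (S.B + 1))
    (h : ∀ i : Fin n, (i : ℕ) < S.m * b → y i = y' i) : S.relayEst w₃ y b = S.relayEst w₃ y' b := by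
  induction b using Fin.induction with
  | zero => rfl
  | succ b ih =>
    rw [relayEst_succ, relayEst_succ, ih fun i hi => h i (hi.trans_le ?_)]
    · congr 1
      funext k
      refine h _ ?_
      rw [time_val, Fin.val_succ, mul_add, mul_one, add_comm]
      exact Nat.add_lt_add_left k.isLt _
    · exact Nat.mul_le_mul_left _ (by simp)

lemma backEst_last {Y : Type*}
    (d : Fin S.B → Fin S.K₁ × Fin S.K₂ → (Fin S.m → Y) → (Fin S.K₁ × Fin S.K₂) × Fin S.K₃)
    (y : Fin n → Y) : S.backEst d y (Fin.last S.B) = (S.dummy₁, S.dummy₂) := by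
  rw [backEst, Fin.reverseInduction_last]

lemma backEst_castSucc {Y : Type*}
    (d : Fin S.B → Fin S.K₁ × Fin S.K₂ → (Fin S.m → Y) → (Fin S.K₁ × Fin S.K₂) × Fin S.K₃)
    (y : Fin n → Y) (b : Fin S.B) :
    S.backEst d y b.castSucc = (d b (S.backEst d y b.succ) (S.block y b)).1 := by
  rw [backEst, Fin.reverseInduction_castSucc]
  rfl

/-- Every decode-and-forward scheme is implemented by a code. -/
lemma exists_implements [Nonempty Y₃] :
    ∃ c : Code X₁ X₂ X₃ Y₁ Y₂ Y₃ M₁ M₂ M₃ n, S.Implements c := by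
  classical
  -- Estimates are defined on full sequences, while the relay knows only the past. By
  -- `relayEst_congr` the arbitrary padding has no influence on the current block.
  let pad : (j : Fin n) → (Fin j → Y₃) → Fin n → Y₃ := fun j y i =>
    if h : (i : ℕ) < j then y ⟨i, h⟩ else Classical.arbitrary Y₃
  refine ⟨
    { enc₁ := fun w => S.atTime (fun b => S.codeword₁ b (S.split₁ w b.castSucc)
        (S.split₁ w b.succ)) S.fill₁
      enc₂ := fun w => S.atTime (fun b => S.codeword₂ b (S.split₂ w b.castSucc)
        (S.split₂ w b.succ)) S.fill₂
      relay := fun j w y => S.atTime (fun b => S.codeword₃ b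
        (S.relayEst w (pad j y) b.castSucc) (S.split₃ w b)) S.fill₃ j
      dec₁ := S.backDec S.recvDec₁
      dec₂ := S.backDec S.recvDec₂ }, ?_⟩
  constructor
  · exact fun w b k => S.atTime_time
      (fun b => S.codeword₁ b (S.split₁ w b.castSucc) (S.split₁ w b.succ)) S.fill₁ b k
  · exact fun w b k => S.atTime_time
      (fun b => S.codeword₂ b (S.split₂ w b.castSucc) (S.split₂ w b.succ)) S.fill₂ b k
  · intro w y b k
    change S.atTime (fun b' => S.codeword₃ b' (S.relayEst w
      (pad (S.time b k) (past y (S.time b k))) b'.castSucc) (S.split₃ w b')) S.fill₃ _ = _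
    rw [atTime_time]
    congr 1
    refine S.relayEst_congr w _ fun i hi => ?_
    have hi' : (i : ℕ) < S.time b k := by
      rw [time_val]
      exact hi.trans_le (Nat.le_add_left _ _)
    simp only [pad, dif_pos hi']
    rfl
  · exact fun w j h => S.atTime_of_le
      (fun b => S.codeword₁ b (S.split₁ w b.castSucc) (S.split₁ w b.succ)) S.fill₁ h
  · exact fun w j h => S.atTime_of_le
      (fun b => S.codeword₂ b (S.split₂ w b.castSucc) (S.split₂ w b.succ)) S.fill₂ h
  · exact fun w y j h => S.atTime_of_le (fun b => S.codeword₃ b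
      (S.relayEst w (pad j (past y j)) b.castSucc) (S.split₃ w b)) S.fill₃ h
  · exact fun y => rfl
  · exact fun y => rfl

/-- The codewords and decoders in the block `b`. -/
def blockCode (b : Fin S.B) : BlockCode X₁ X₂ X₃ Y₁ Y₂ Y₃ S.K₁ S.K₂ S.K₃ S.m :=
  ⟨S.codeword₁ b, S.codeword₂ b, S.codeword₃ b, S.relayDec b, S.recvDec₁ b, S.recvDec₂ b⟩

/-- The sub-messages of the two sources with index `b`. -/
def sub (w₁ : Fin M₁) (w₂ : Fin M₂) (b : Fin (S.B + 1)) : Fin S.K₁ × Fin S.K₂ :=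
  (S.split₁ w₁ b, S.split₂ w₂ b)

/-- The relay or a receiver errs in the block `b`. -/
def BlockFails (w₁ : Fin M₁) (w₂ : Fin M₂) (w₃ : Fin M₃) (y : Fin n → Y₁ × Y₂ × Y₃)
    (b : Fin S.B) : Prop :=
  (S.blockCode b).Fails (S.sub w₁ w₂ b.castSucc) (S.sub w₁ w₂ b.succ) (S.split₃ w₃ b)
    (S.block y b)

variable {S} {w₁ : Fin M₁} {w₂ : Fin M₂} {w₃ : Fin M₃} {y : Fin n → Y₁ × Y₂ × Y₃}

/-- Induction from the known first sub-message: with a correct estimate, the decoder sees exactly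
the input for which `BlockFails` is defined. The receivers argue alike from the known last
sub-message in `backEst_eq`. -/
lemma relayEst_eq (h : ∀ b, ¬S.BlockFails w₁ w₂ w₃ y b) (b : Fin (S.B + 1)) :
    S.relayEst w₃ (fun i => (y i).2.2) b = S.sub w₁ w₂ b := by
  induction b using Fin.induction with
  | zero => rw [relayEst_zero, sub, S.first₁, S.first₂]
  | succ b ih =>
    rw [relayEst_succ, ih]
    by_contra hne
    exact h b (Or.inl hne)

lemma backEst_eq {Y : Type*} {y : Fin n → Y}
    {d : Fin S.B → Fin S.K₁ × Fin S.K₂ → (Fin S.m → Y) → (Fin S.K₁ × Fin S.K₂) × Fin S.K₃}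
    (h : ∀ b, d b (S.sub w₁ w₂ b.succ) (S.block y b) = (S.sub w₁ w₂ b.castSucc, S.split₃ w₃ b))
    (b : Fin (S.B + 1)) : S.backEst d y b = S.sub w₁ w₂ b := by
  induction b using Fin.reverseInduction with
  | last => rw [backEst_last, sub, S.last₁, S.last₂]
  | cast b ih => rw [backEst_castSucc, ih, h]

lemma backDec_eq {Y : Type*} {y : Fin n → Y}
    {d : Fin S.B → Fin S.K₁ × Fin S.K₂ → (Fin S.m → Y) → (Fin S.K₁ × Fin S.K₂) × Fin S.K₃}
    (h : ∀ b, d b (S.sub w₁ w₂ b.succ) (S.block y b) =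
      (S.sub w₁ w₂ b.castSucc, S.split₃ w₃ b)) : S.backDec d y = (w₁, w₂, w₃) := by
  simp only [backDec, backEst_eq h, h]
  exact Prod.ext (S.merge_split₁ w₁) (Prod.ext (S.merge_split₂ w₂) (S.merge_split₃ w₃))

lemma relayMsgs_eq (h : ∀ b, ¬S.BlockFails w₁ w₂ w₃ y b) :
    S.relayMsgs w₃ (fun i => (y i).2.2) = (w₁, w₂) := by
  simp only [relayMsgs, relayEst_eq h]
  exact Prod.ext (S.merge_split₁ w₁) (S.merge_split₂ w₂)

lemma backDec₁_eq (h : ∀ b, ¬S.BlockFails w₁ w₂ w₃ y b) :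
    S.backDec S.recvDec₁ (fun i => (y i).1) = (w₁, w₂, w₃) :=
  backDec_eq fun b => by
    by_contra hne
    exact h b (Or.inr (Or.inl hne))

lemma backDec₂_eq (h : ∀ b, ¬S.BlockFails w₁ w₂ w₃ y b) :
    S.backDec S.recvDec₂ (fun i => (y i).2.1) = (w₁, w₂, w₃) :=
  backDec_eq fun b => by
    by_contra hne
    exact h b (Or.inr (Or.inr hne))

section
variable [Fintype Y₁] [Fintype Y₂] [Fintype Y₃] (W : Channel X₁ X₂ X₃ Y₁ Y₂ Y₃)
  {c : Code X₁ X₂ X₃ Y₁ Y₂ Y₃ M₁ M₂ M₃ n}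

variable (S w₁ w₂ w₃) in
/-- The input of the relay that knows the previous sub-messages. -/
def genieInput : Fin n → X₃ :=
  S.atTime (fun b => S.codeword₃ b (S.sub w₁ w₂ b.castSucc) (S.split₃ w₃ b)) S.fill₃

/-- The genie-aided input is a function of the messages alone. Replacing the real input by it
removes the dependence on past outputs. -/
lemma relay_eq_genieInput (hc : S.Implements c) (h : ∀ b, ¬S.BlockFails w₁ w₂ w₃ y b)
    (j : Fin n) :
    c.relay j w₃ (past (fun i => (y i).2.2) j) = S.genieInput w₁ w₂ w₃ j := by
  by_cases hj : (j : ℕ) < S.B * S.m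
  · obtain ⟨b, k, rfl⟩ := S.exists_time_of_lt hj
    rw [hc.relay, relayEst_eq h, genieInput, atTime_time]
  · rw [hc.relay_fill _ _ _ (not_lt.1 hj), genieInput, atTime_of_le _ _ _ (not_lt.1 hj)]

lemma sum_outputProb (c : Code X₁ X₂ X₃ Y₁ Y₂ Y₃ M₁ M₂ M₃ n) (w₁ : Fin M₁) (w₂ : Fin M₂)
    (w₃ : Fin M₃) : ∑ y, outputProb W c w₁ w₂ w₃ y = 1 :=
  sum_prod_causal fun j (y : Fin j → Y₁ × Y₂ × Y₃) =>
    W (c.enc₁ w₁ j) (c.enc₂ w₂ j) (c.relay j w₃ fun i => (y i).2.2)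

open Classical in
/-- The probability of an event that does not occur unless a decoder errs in some block. -/
lemma sum_outputProb_le (hc : S.Implements c) (w₁ : Fin M₁) (w₂ : Fin M₂) (w₃ : Fin M₃)
    {E : (Fin n → Y₁ × Y₂ × Y₃) → Prop} (hE : ∀ y, E y → ∃ b, S.BlockFails w₁ w₂ w₃ y b) :
    (∑ y, if E y then outputProb W c w₁ w₂ w₃ y else 0) ≤
      ∑ b, prob ((S.blockCode b).outDist W (S.sub w₁ w₂ b.castSucc) (S.sub w₁ w₂ b.succ)
        (S.split₃ w₃ b)) ((S.blockCode b).Fails (S.sub w₁ w₂ b.castSucc) (S.sub w₁ w₂ b.succ)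
        (S.split₃ w₃ b)) := by
  set G : Dist (Fin n → Y₁ × Y₂ × Y₃) :=
    piDist fun j => W (c.enc₁ w₁ j) (c.enc₂ w₂ j) (S.genieInput w₁ w₂ w₃ j) with hG
  have hpos : ∀ y, 0 ≤ outputProb W c w₁ w₂ w₃ y := fun y =>
    Finset.prod_nonneg fun j _ => (W _ _ _).2.1 _
  have hgood : ∀ y, (¬∃ b, S.BlockFails w₁ w₂ w₃ y b) → outputProb W c w₁ w₂ w₃ y = G.1 y := by
    intro y hy
    refine Finset.prod_congr rfl fun j _ => ?_
    rw [relay_eq_genieInput hc (not_exists.1 hy)]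
  -- The probability of `E` is at most one minus the real mass of the outcomes without failure. That
  -- mass is the same under `G`, so the complement is the failure probability under `G`.
  have h1 : (∑ y, if E y then outputProb W c w₁ w₂ w₃ y else 0) ≤
      prob G fun y => ∃ b, S.BlockFails w₁ w₂ w₃ y b := by
    have h2 : (∑ y, if E y then outputProb W c w₁ w₂ w₃ y else 0) ≤
        ∑ y, (outputProb W c w₁ w₂ w₃ y -
          if ∃ b, S.BlockFails w₁ w₂ w₃ y b then 0 else G.1 y) := by
      refine Finset.sum_le_sum fun y _ => ?_
      by_cases hy : ∃ b, S.BlockFails w₁ w₂ w₃ y b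
      · rw [if_pos hy, sub_zero]
        split_ifs
        exacts [le_rfl, hpos y]
      · rw [if_neg hy, if_neg fun h => hy (hE y h), hgood y hy, sub_self]
    refine h2.trans (le_of_eq ?_)
    rw [Finset.sum_sub_distrib, sum_outputProb, ← G.2.2, ← Finset.sum_sub_distrib, prob, expect]
    refine Finset.sum_congr rfl fun y _ => ?_
    split_ifs <;> simp
  refine h1.trans ((prob_mono G (P' := fun y => ∃ b ∈ Finset.univ, S.BlockFails w₁ w₂ w₃ y b)
    fun y ⟨b, hb⟩ => ⟨b, Finset.mem_univ b, hb⟩).trans ((prob_exists_le G Finset.univ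
      fun b y => S.BlockFails w₁ w₂ w₃ y b).trans (Finset.sum_le_sum fun b _ => le_of_eq ?_)))
  -- Under `G` the outputs at different times are independent, so a block has the law assumed for
  -- block codes.
  refine (expect_piDist_comp _ (S.time_injective b) fun z =>
    if (S.blockCode b).Fails (S.sub w₁ w₂ b.castSucc) (S.sub w₁ w₂ b.succ) (S.split₃ w₃ b) z
      then 1 else 0).trans ?_
  rw [prob, BlockCode.outDist]
  congr 2
  funext k
  simp only [Function.comp_apply, hc.enc₁, hc.enc₂, genieInput, atTime_time]
  rfl

/-- Dividing the sum over all message triples and blocks by the number of triples leaves one factor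
`S.B`. -/
lemma averageProb_le (hc : S.Implements c)
    {E : Fin M₁ → Fin M₂ → Fin M₃ → (Fin n → Y₁ × Y₂ × Y₃) → Prop}
    (hE : ∀ w₁ w₂ w₃ y, E w₁ w₂ w₃ y → ∃ b, S.BlockFails w₁ w₂ w₃ y b) {ε : ℝ} (hε : 0 ≤ ε)
    (h : ∑ i : Fin M₁ × Fin M₂ × Fin M₃ × Fin S.B,
      prob ((S.blockCode i.2.2.2).outDist W (S.sub i.1 i.2.1 i.2.2.2.castSucc)
        (S.sub i.1 i.2.1 i.2.2.2.succ) (S.split₃ i.2.2.1 i.2.2.2))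
        ((S.blockCode i.2.2.2).Fails (S.sub i.1 i.2.1 i.2.2.2.castSucc)
        (S.sub i.1 i.2.1 i.2.2.2.succ) (S.split₃ i.2.2.1 i.2.2.2)) ≤
      Fintype.card (Fin M₁ × Fin M₂ × Fin M₃ × Fin S.B) * ε) :
    averageProb W c E ≤ S.B * ε := by
  classical
  simp only [Fintype.sum_prod_type, Fintype.card_prod, Fintype.card_fin, Nat.cast_mul] at h
  have h1 := (Finset.sum_le_sum fun w₁ _ => Finset.sum_le_sum fun w₂ _ =>
    Finset.sum_le_sum fun w₃ _ => sum_outputProb_le W hc w₁ w₂ w₃ (hE w₁ w₂ w₃)).trans h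
  rw [averageProb]
  rcases (by positivity : (0 : ℝ) ≤ (M₁ : ℝ) * M₂ * M₃).eq_or_lt with h0 | h0
  · rw [← h0, div_zero, zero_mul]
    positivity
  · rw [one_div, inv_mul_le_iff₀ h0]
    refine h1.trans (le_of_eq ?_)
    ring

lemma averageProb_nonneg (c : Code X₁ X₂ X₃ Y₁ Y₂ Y₃ M₁ M₂ M₃ n)
    (E : Fin M₁ → Fin M₂ → Fin M₃ → (Fin n → Y₁ × Y₂ × Y₃) → Prop) : 0 ≤ averageProb W c E := by
  classical
  refine mul_nonneg (by positivity) (Finset.sum_nonneg fun _ _ => Finset.sum_nonneg fun _ _ =>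
    Finset.sum_nonneg fun _ _ => Finset.sum_nonneg fun _ _ => ?_)
  split_ifs
  · exact Finset.prod_nonneg fun j _ => (W _ _ _).2.1 _
  · exact le_rfl

end

end DFScheme

/-! ### Choice of the number of blocks and of the sub-message counts. -/

section Rates

/-- The number of sub-messages of a message of rate `R` that is split into `B` sub-messages. -/
def subCount (R : ℝ) (B n : ℕ) : ℕ := ⌈(2 : ℝ) ^ ((n : ℝ) * R / B)⌉₊

lemma numMsgs_pos {R : ℝ} (hR : 0 ≤ R) (n : ℕ) : 0 < numMsgs R n :=
  Nat.floor_pos.2 (Real.one_le_rpow one_le_two (by positivity))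

lemma numMsgs_le_pow (R : ℝ) {B : ℕ} (hB : 0 < B) (n : ℕ) : numMsgs R n ≤ subCount R B n ^ B := by
  have h1 : ((numMsgs R n : ℕ) : ℝ) ≤ ((subCount R B n ^ B : ℕ) : ℝ) := by
    push_cast
    calc ((numMsgs R n : ℕ) : ℝ) ≤ 2 ^ ((n : ℝ) * R) := Nat.floor_le (by positivity)
      _ = ((2 : ℝ) ^ ((n : ℝ) * R / B)) ^ B := by
          rw [← Real.rpow_mul_natCast two_pos.le, div_mul_cancel₀]
          exact_mod_cast hB.ne'
      _ ≤ (subCount R B n : ℝ) ^ B := pow_le_pow_left₀ (by positivity) (Nat.le_ceil _) B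
  exact_mod_cast h1

lemma subCount_pos (R : ℝ) (B n : ℕ) : 0 < subCount R B n := Nat.ceil_pos.2 (by positivity)

/-- Since `n ≤ (B + 1) (m + 1)`, the exponent `n θ R / B` is at most `(m + 1) ρ R`. The extra letter
costs `2 ^ (ρ R)` and the ceiling a factor `2`; neither depends on `n`. -/
lemma sizeBound_subCount {θ ρ R c : ℝ} {B : ℕ} (hθ : 0 ≤ θ) (hR : 0 ≤ R) (hB : 0 < B)
    (h : θ * (B + 1) ≤ ρ * B) (hc : 2 * 2 ^ (ρ * R) ≤ c) (n : ℕ) :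
    SizeBound c ρ R (n / (B + 1)) (subCount (θ * R) B n) := by
  refine ⟨subCount_pos _ _ _, ?_, fun h0 => by simp [subCount, h0]⟩
  have hB' : (0 : ℝ) < B := by exact_mod_cast hB
  set m := n / (B + 1)
  have hn : (n : ℝ) ≤ (B + 1) * (m + 1) := by
    exact_mod_cast (Nat.lt_mul_div_succ n (Nat.succ_pos B)).le
  have hx : (n : ℝ) * (θ * R) / B ≤ ρ * R + m * (ρ * R) := by
    rw [div_le_iff₀ hB']
    calc (n : ℝ) * (θ * R) ≤ ((B + 1) * (m + 1)) * (θ * R) :=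
          mul_le_mul_of_nonneg_right hn (by positivity)
      _ = (θ * (B + 1)) * ((m + 1) * R) := by ring
      _ ≤ (ρ * B) * ((m + 1) * R) := mul_le_mul_of_nonneg_right h (by positivity)
      _ = (ρ * R + m * (ρ * R)) * B := by ring
  have h1 : (1 : ℝ) ≤ 2 ^ ((n : ℝ) * (θ * R) / B) :=
    Real.one_le_rpow one_le_two (by positivity)
  calc ((subCount (θ * R) B n : ℕ) : ℝ) ≤ 2 ^ ((n : ℝ) * (θ * R) / B) + 1 :=
        (Nat.ceil_lt_add_one (by positivity)).le
    _ ≤ 2 * 2 ^ ((n : ℝ) * (θ * R) / B) := by linarith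
    _ ≤ 2 * 2 ^ (ρ * R + m * (ρ * R)) :=
        mul_le_mul_of_nonneg_left (Real.rpow_le_rpow_of_exponent_le one_le_two hx) two_pos.le
    _ = 2 * 2 ^ (ρ * R) * 2 ^ (m * (ρ * R)) := by rw [Real.rpow_add two_pos]; ring
    _ ≤ c * 2 ^ (m * (ρ * R)) := mul_le_mul_of_nonneg_right hc (by positivity)

/-- `B + 1` blocks carry only `B` fresh sub-messages of a source. The loss `B / (B + 1)` fits
between `θ` and `ρ` once `B` is large. -/
lemma exists_blocks {θ : ℝ} (hθ : 0 ≤ θ) (hθ' : θ < 1) :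
    ∃ ρ : ℝ, 0 ≤ ρ ∧ ρ < 1 ∧ ∃ B : ℕ, 0 < B ∧ θ * (B + 1) ≤ ρ * B := by
  obtain ⟨ρ, h1, h2⟩ := exists_between hθ'
  obtain ⟨B, hB⟩ := exists_nat_gt (θ / (ρ - θ))
  have h3 : 0 < ρ - θ := sub_pos.2 h1
  have hB0 : (0 : ℝ) < B := (div_nonneg hθ h3.le).trans_lt hB
  refine ⟨ρ, hθ.trans h1.le, h2, B, by exact_mod_cast hB0, ?_⟩
  rw [div_lt_iff₀ h3] at hB
  linarith

end Rates

lemma nonempty_of_dist {α : Type*} [Fintype α] (d : Dist α) : Nonempty α := by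
  by_contra h
  rw [not_nonempty_iff] at h
  simpa using d.2.2

/-! ### Assembling the code, and the theorem. -/

section Achievability
variable {X₁ X₂ X₃ Y₁ Y₂ Y₃ : Type*} [Fintype Y₁] [Fintype Y₂] [Fintype Y₃]
  (W : Channel X₁ X₂ X₃ Y₁ Y₂ Y₃)

/-- Block codes with a small error probability for the sub-messages yield codes that operate by
decode-and-forward and have a small error probability. -/
lemma exists_scheme [Nonempty X₁] [Nonempty X₂] [Nonempty X₃] [Nonempty Y₃]
    {M₁ M₂ M₃ K₁ K₂ K₃ B n : ℕ} (hM₁ : 0 < M₁) (hM₂ : 0 < M₂) (hM₃ : 0 < M₃) (hK₁ : 0 < K₁)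
    (hK₂ : 0 < K₂) (hMK₁ : M₁ ≤ K₁ ^ B) (hMK₂ : M₂ ≤ K₂ ^ B) (hMK₃ : M₃ ≤ K₃ ^ (B + 1)) {ε : ℝ}
    (hε : 0 ≤ ε)
    (H : ∀ (ι : Type) [Fintype ι] (a f : ι → Fin K₁ × Fin K₂) (a₃ : ι → Fin K₃),
      ∃ b : BlockCode X₁ X₂ X₃ Y₁ Y₂ Y₃ K₁ K₂ K₃ (n / (B + 1)),
        ∑ i, prob (b.outDist W (a i) (f i) (a₃ i)) (b.Fails (a i) (f i) (a₃ i)) ≤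
          Fintype.card ι * ε) :
    ∃ (c : Code X₁ X₂ X₃ Y₁ Y₂ Y₃ M₁ M₂ M₃ n) (S : DFScheme X₁ X₂ X₃ Y₁ Y₂ Y₃ M₁ M₂ M₃ n),
      S.Implements c ∧ errorProb W c ≤ (B + 1 : ℕ) * ε ∧
        relayErrorProb W c S ≤ (B + 1 : ℕ) * ε := by
  obtain ⟨s₁, g₁, hf₁, hl₁, hg₁⟩ := exists_split hM₁ ⟨0, hK₁⟩ hMK₁
  obtain ⟨s₂, g₂, hf₂, hl₂, hg₂⟩ := exists_split hM₂ ⟨0, hK₂⟩ hMK₂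
  obtain ⟨s₃, hs₃⟩ := exists_injective_of_le_pow hMK₃
  have : Nonempty (Fin M₃) := ⟨⟨0, hM₃⟩⟩
  -- The family is indexed by all message triples and all blocks, so its average is exactly the one
  -- that `averageProb_le` needs.
  obtain ⟨b, hb⟩ := H (Fin M₁ × Fin M₂ × Fin M₃ × Fin (B + 1))
    (fun i => (s₁ i.1 i.2.2.2.castSucc, s₂ i.2.1 i.2.2.2.castSucc))
    (fun i => (s₁ i.1 i.2.2.2.succ, s₂ i.2.1 i.2.2.2.succ)) (fun i => s₃ i.2.2.1 i.2.2.2)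
  let S : DFScheme X₁ X₂ X₃ Y₁ Y₂ Y₃ M₁ M₂ M₃ n :=
    { B := B + 1
      m := n / (B + 1)
      fits := Nat.mul_div_le n (B + 1)
      K₁ := K₁
      K₂ := K₂
      K₃ := K₃
      dummy₁ := ⟨0, hK₁⟩
      dummy₂ := ⟨0, hK₂⟩
      split₁ := s₁
      split₂ := s₂
      split₃ := s₃
      first₁ := hf₁
      first₂ := hf₂
      last₁ := hl₁
      last₂ := hl₂
      merge₁ := g₁
      merge₂ := g₂
      merge₃ := Function.invFun s₃
      merge_split₁ := hg₁
      merge_split₂ := hg₂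
      merge_split₃ := Function.leftInverse_invFun hs₃
      codeword₁ := fun _ => b.enc₁
      codeword₂ := fun _ => b.enc₂
      codeword₃ := fun _ => b.enc₃
      fill₁ := Classical.arbitrary X₁
      fill₂ := Classical.arbitrary X₂
      fill₃ := Classical.arbitrary X₃
      relayDec := fun _ => b.relayDec
      recvDec₁ := fun _ => b.recvDec₁
      recvDec₂ := fun _ => b.recvDec₂ }
  obtain ⟨c, hc⟩ := S.exists_implements
  refine ⟨c, S, hc, ?_, ?_⟩
  · refine DFScheme.averageProb_le W hc (fun w₁ w₂ w₃ y hy => ?_) hε hb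
    by_contra! hno
    rw [hc.dec₁, hc.dec₂, DFScheme.backDec₁_eq hno, DFScheme.backDec₂_eq hno] at hy
    simp at hy
  · refine DFScheme.averageProb_le W hc (fun w₁ w₂ w₃ y hy => ?_) hε hb
    by_contra! hno
    exact hy (DFScheme.relayMsgs_eq hno)

lemma dfAchievableRates_subset : dfAchievableRates W ⊆ achievableRates W := by
  rintro R ⟨h₁, h₂, h₃, c, S, -, hc, -⟩
  exact ⟨h₁, h₂, h₃, c, hc⟩

end Achievability

end CMACr

end

open CMACr in
theorem proposition4 {X₁ X₂ X₃ Y₁ Y₂ Y₃ Q U₁ U₂ : Type*}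
    [Fintype X₁] [Fintype X₂] [Fintype X₃] [Fintype Y₁] [Fintype Y₂] [Fintype Y₃]
    [Fintype Q] [Fintype U₁] [Fintype U₂]
    (W : Channel X₁ X₂ X₃ Y₁ Y₂ Y₃) (P : InputLaw Q U₁ U₂ X₁ X₂ X₃) (R₁ R₂ R₃ : ℝ)
    (hR₁ : 0 ≤ R₁) (hR₂ : 0 ≤ R₂) (hR₃ : 0 ≤ R₃)
    (h₁ : R₁ ≤ condMI (P.joint W) (fun ω => ω.x₁) (fun ω => ω.y₃)
      (fun ω => (ω.u₁, ω.x₂, ω.x₃, ω.q)))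
    (h₂ : R₂ ≤ condMI (P.joint W) (fun ω => ω.x₂) (fun ω => ω.y₃)
      (fun ω => (ω.u₂, ω.x₁, ω.x₃, ω.q)))
    (h₁₂ : R₁ + R₂ ≤ condMI (P.joint W) (fun ω => (ω.x₁, ω.x₂)) (fun ω => ω.y₃)
      (fun ω => (ω.u₁, ω.u₂, ω.x₃, ω.q)))
    (h₃ : R₃ ≤ min
      (condMI (P.joint W) (fun ω => ω.x₃) (fun ω => ω.y₁)
        (fun ω => (ω.x₁, ω.x₂, ω.u₁, ω.u₂, ω.q)))
      (condMI (P.joint W) (fun ω => ω.x₃) (fun ω => ω.y₂)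
        (fun ω => (ω.x₁, ω.x₂, ω.u₁, ω.u₂, ω.q))))
    (h₁₃ : R₁ + R₃ ≤ min
      (condMI (P.joint W) (fun ω => (ω.x₁, ω.x₃)) (fun ω => ω.y₁) (fun ω => (ω.x₂, ω.u₂, ω.q)))
      (condMI (P.joint W) (fun ω => (ω.x₁, ω.x₃)) (fun ω => ω.y₂) (fun ω => (ω.x₂, ω.u₂, ω.q))))
    (h₂₃ : R₂ + R₃ ≤ min
      (condMI (P.joint W) (fun ω => (ω.x₂, ω.x₃)) (fun ω => ω.y₁) (fun ω => (ω.x₁, ω.u₁, ω.q)))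
      (condMI (P.joint W) (fun ω => (ω.x₂, ω.x₃)) (fun ω => ω.y₂) (fun ω => (ω.x₁, ω.u₁, ω.q))))
    (h₁₂₃ : R₁ + R₂ + R₃ ≤ min
      (condMI (P.joint W) (fun ω => (ω.x₁, ω.x₂, ω.x₃)) (fun ω => ω.y₁) (fun ω => ω.q))
      (condMI (P.joint W) (fun ω => (ω.x₁, ω.x₂, ω.x₃)) (fun ω => ω.y₂) (fun ω => ω.q))) :
    (∀ θ : ℝ, 0 ≤ θ → θ < 1 → (θ * R₁, θ * R₂, θ * R₃) ∈ dfAchievableRates W) ∧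
      (R₁, R₂, R₃) ∈ closure (dfAchievableRates W) ∧ (R₁, R₂, R₃) ∈ capacityRegion W := by
  have main : ∀ θ : ℝ, 0 ≤ θ → θ < 1 →
      (θ * R₁, θ * R₂, θ * R₃) ∈ dfAchievableRates W := by
    intro θ hθ hθ'
    obtain ⟨q⟩ := nonempty_of_dist P.q
    obtain ⟨⟨x₁, u₁⟩⟩ := nonempty_of_dist (P.xu₁ q)
    obtain ⟨⟨x₂, u₂⟩⟩ := nonempty_of_dist (P.xu₂ q)
    obtain ⟨x₃⟩ := nonempty_of_dist (P.x₃ u₁ u₂ q)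
    obtain ⟨⟨-, -, y₃⟩⟩ := nonempty_of_dist (W x₁ x₂ x₃)
    have : Nonempty X₁ := ⟨x₁⟩
    have : Nonempty X₂ := ⟨x₂⟩
    have : Nonempty X₃ := ⟨x₃⟩
    have : Nonempty Y₃ := ⟨y₃⟩
    obtain ⟨κ, d, hd, hκ⟩ := exists_kernels P W
    rw [← hd] at h₁ h₂ h₁₂ h₃ h₁₃ h₂₃ h₁₂₃
    obtain ⟨ρ, hρ0, hρ1, B, hB, hθB⟩ := exists_blocks hθ hθ'
    -- As `ρ ≥ 0`, this constant dominates those of the three individual rates.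
    set c : ℝ := 2 * 2 ^ (ρ * (R₁ + R₂ + R₃)) with hc
    have hcR : ∀ R, R ≤ R₁ + R₂ + R₃ → 2 * 2 ^ (ρ * R) ≤ c := fun R hR =>
      mul_le_mul_of_nonneg_left (Real.rpow_le_rpow_of_exponent_le one_le_two
        (mul_le_mul_of_nonneg_left hR hρ0)) two_pos.le
    obtain ⟨ε, hε, H⟩ := exists_blockCode hκ hR₁ hR₂ hR₃ (c := c) (by positivity) hρ1 h₁ h₂ h₁₂
      h₃ h₁₃ h₂₃ h₁₂₃
    have hn : ∀ n : ℕ, ∃ (C : Code X₁ X₂ X₃ Y₁ Y₂ Y₃ (numMsgs (θ * R₁) n) (numMsgs (θ * R₂) n)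
          (numMsgs (θ * R₃) n) n)
        (S : DFScheme X₁ X₂ X₃ Y₁ Y₂ Y₃ (numMsgs (θ * R₁) n) (numMsgs (θ * R₂) n)
          (numMsgs (θ * R₃) n) n),
        S.Implements C ∧ errorProb W C ≤ (B + 1 : ℕ) * |ε (n / (B + 1))| ∧
          relayErrorProb W C S ≤ (B + 1 : ℕ) * |ε (n / (B + 1))| := by
      intro n
      -- The relay has `B + 1` sub-messages at its disposal, but the counts are already large enough
      -- for `B`.
      refine exists_scheme W (numMsgs_pos (by positivity) n) (numMsgs_pos (by positivity) n)
        (numMsgs_pos (by positivity) n) (subCount_pos _ B n) (subCount_pos _ B n)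
        (numMsgs_le_pow _ hB n) (numMsgs_le_pow _ hB n) ((numMsgs_le_pow _ hB n).trans
          (Nat.pow_le_pow_right (subCount_pos _ B n) (Nat.le_succ B))) (abs_nonneg _)
        fun ι _ a f a₃ => ?_
      obtain ⟨b, hb⟩ := H (sizeBound_subCount hθ hR₁ hB hθB (hcR R₁ (by linarith)) n)
        (sizeBound_subCount hθ hR₂ hB hθB (hcR R₂ (by linarith)) n)
        (sizeBound_subCount hθ hR₃ hB hθB (hcR R₃ (by linarith)) n) ι a f a₃
      exact ⟨b, hb.trans (mul_le_mul_of_nonneg_left (le_abs_self _) (Nat.cast_nonneg _))⟩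
    choose C S hS hC hrel using hn
    -- The number of blocks is constant and the block length `n / (B + 1)` tends to infinity.
    -- Absolute values are taken because `ε` is not known to be nonnegative.
    have hlim : Tendsto (fun n => ((B + 1 : ℕ) : ℝ) * |ε (n / (B + 1))|) atTop (𝓝 0) := by
      have h1 := ((hε.comp (Nat.tendsto_div_const_atTop (Nat.succ_ne_zero B))).abs).const_mul
        ((B + 1 : ℕ) : ℝ)
      simpa using h1
    exact ⟨mul_nonneg hθ hR₁, mul_nonneg hθ hR₂, mul_nonneg hθ hR₃, C, S, hS,
      squeeze_zero (fun n => DFScheme.averageProb_nonneg W _ _) hC hlim,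
      squeeze_zero (fun n => DFScheme.averageProb_nonneg W _ _) hrel hlim⟩
  have hclosure : (R₁, R₂, R₃) ∈ closure (dfAchievableRates W) := by
    have h1 : Tendsto (fun θ : ℝ => (θ * R₁, θ * R₂, θ * R₃)) (𝓝[<] 1) (𝓝 (R₁, R₂, R₃)) := by
      have h2 : Continuous fun θ : ℝ => (θ * R₁, θ * R₂, θ * R₃) := by fun_prop
      simpa using (h2.tendsto 1).mono_left nhdsWithin_le_nhds
    refine mem_closure_of_tendsto h1 ?_
    filter_upwards [Ioo_mem_nhdsLT (zero_lt_one' ℝ)] with θ hθ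
    exact main θ hθ.1.le hθ.2
  exact ⟨main, hclosure, closure_mono (dfAchievableRates_subset W) hclosure⟩
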